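/- Let $(K,\nu)$ be a valued field with $\nu$ of archimedean rank one, and let $\mu$ be a valuation of $K[x]$ extending $\nu$, with values in a totally ordered abelian group $\Gamma'$ (so $\mu(f)=\infty$ only for $f=0$). For a valuation $w$ of $K[x]$ let $P_\beta=\{f : w(f)\ge\beta\}$, $P_{\beta+}=\{f : w(f)>\beta\}$, $G_w=\bigoplus_{\beta} P_\beta/P_{\beta+}$, and let $\mathrm{in}_w f$ be the image of $f\neq 0$ in $P_{w(f)}/P_{w(f)+}$ ($\mathrm{in}_w 0=0$). Polynomials $f,g$ are $w$-equivalent if $\mathrm{in}_wf=\mathrm{in}_wg$; $g$ $w$-divides $f$ if $f$ is $w$-equivalent to $hg$ for some $h\in K[x]$. A (Vaquié) key polynomial for $w$ is a monic $\phi$ such that $\deg f\ge\deg\phi$ whenever $f\ne0$ is $w$-divisible by $\phi$, and such that $\phi$ $w$-divides $f$ or $g$ whenever it $w$-divides $fg$. For such a $\phi$, of positive degree, and $\gamma>w(\phi)$, a valuation $w'$ of $K[x]$ is the augmented valuation $[w;w'(\phi)=\gamma]$ if $w'(f)=\min_j\{w(f_j)+j\gamma\}$ for every $f=\sum_j f_j\phi^j$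 with $\deg f_j<\deg\phi$. A family $(\mu_a)_{a\in A}$ of valuations indexed by a totally ordered set, with polynomials $\phi_a$ and values $\gamma_a$, is a family of augmented iterated valuations if for each non-minimal $a\in A$ there is $\theta<a$ with $\mu_a=[\mu_\theta;\mu_a(\phi_a)=\gamma_a]$ and: (1) if $a$ has an immediate predecessor, then $\theta$ is that predecessor and, if $\theta$ is not the least element of $A$, $\phi_a$ and $\phi_\theta$ are not $\mu_\theta$-equivalent and $\deg\phi_\theta\le\deg\phi_a$; (2) if $a$ has no immediate predecessor, then for all $\theta<b<a$ we have $\mu_b=[\mu_\theta;\mu_b(\phi_b)=\gamma_b]$, $\mu_a=[\mu_b;\mu_a(\phi_a)=\gamma_a]$ and $\deg\phi_a=\deg\phi_b$. Let $\{Q_j\}_{1\le j<L}$ ($L$ an ordinal), with positive integers $\alpha_j$, be a set of Herrera Govantes–Olalla Acosta–Spivakovsky (HOS) key polynomials for $\mu$, and put $\beta_j=\mu(Q_j)$. This means the following. For $j<l$, the index $j$ is $l$-essential if there is an integer $t>0$ with $j+t=l$, or with $j+t<l$ and $\alpha_{j+t}>1$; put $j+ = j+1$ if $j$ is $l$-essential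 and $j+ = j+\omega$ otherwise. An $l$-standard monomial not involving $Q_l$ is $c\prod_{1\le j<l}Q_j^{g_j}$ with $c\in K$, finitely many $g_j\ne0$, $0\le g_j<\alpha_{j+}$, and, for each $l$-inessential $j$, at most one $k<j+$ with $k+=j+$ and $g_k\neq0$. An $l$-standard expansion not involving $Q_l$ is a finite sum of such monomials (with distinct exponents) such that, for each $\beta$ occurring as the value of a monomial, the $\mathrm{in}_\mu$ of the monomials of value $\beta$ have non-zero sum; an $l$-standard expansion of $h$ is $h=\sum_j d_jQ_l^j$ with each $d_j$ an $l$-standard expansion not involving $Q_l$. It is required that $Q_1=x$, $\alpha_1=1$; that for each $l<L$ only finitely many $j\le l$ have $\alpha_j\ne1$; that for each $1\le l<L$ every $h\in K[x]$ has an $l$-standard expansion; and: * if $j=l+1<L$, $l\ge1$, then $Q_{j}=Q_l^{\alpha_{j}}+\sum_{k<\alpha_{j}}c_kQ_l^k$ with $l$-standard expansions $c_k$ not involving $Q_l$, all monomials on the right-hand side have the same $\mu$-value, and replacing each monomial by its initial form gives the minimal algebraic relation of $\mathrm{in}_\mu Q_l$ over $G_\nu[\mathrm{in}_\mu Q_k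 : k<l]$; * if $j<L$ is a limit ordinal, then $k_\nu$ has characteristic $p>0$, and there are a $j$-inessential $j_0<j$ with $j_0+=j$, an integer $e>0$ with $\alpha_j=p^e$, and $j_0$-standard expansions $c_0,c_{p^k}$ not involving $Q_{j_0}$, $c_{p^e}=1$, with $Q_j=c_0+\sum_{k=0}^{e}c_{p^k}Q_{j_0}^{p^k}$; and there is a positive $\bar\beta\in\Gamma'$ with $\bar\beta>\beta_q$ for all $q<j$, $\beta_j\ge p^e\bar\beta$ and $p^k\bar\beta+\mu(c_{p^k})=p^e\bar\beta$ whenever $0\le k\le e$ and $c_{p^k}\neq0$. Let $i\ge1$ with $i+1<L$ and $\deg Q_i=\deg Q_{i+1}$. Then for $l\in\{i,i+1\}$ there is a (unique) valuation $\nu_l$ of $K[x]$ with $\nu_l(h)=\min_j\{j\beta_l+\mu(d_j)\}$ for every $l$-standard expansion $h=\sum_jd_jQ_l^j$, and the following hold. For $\beta\in\Gamma'$, say that $Q\in K[x]$ is attached to $\beta$ if $Q=Q_i+z$ with $z$ an $i$-standard expansion not involving $Q_i$, $\nu_i(Q)=\nu_i(Q_i)=\nu_i(z)$ and $\nu_{i+1}(Q)=\beta>\beta_i$.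 1. For each $\beta\in\nu_i(K[x]\setminus\{0\})$ with $\beta_i<\beta<\beta_{i+1}$ there is a polynomial attached to $\beta$. 2. Let $\Delta$ be any set of elements $\delta\in\Gamma'$ with $\beta_i\le\delta\le\beta_{i+1}$, and for each $\delta\in\Delta$ with $\delta>\beta_i$ let $Q_\delta$ be any polynomial attached to $\delta$ (for instance $Q_{\delta}=Q_{i+1}$ if $\delta=\beta_{i+1}$); if $\beta_i\in\Delta$, put $Q_{\delta}=Q_i$ for $\delta=\beta_i$. Then there are valuations $\nu_\delta$ ($\delta\in\Delta$) of $K[x]$ with $\nu_\delta=[\nu_i;\nu_\delta(Q_\delta)=\delta]$ for $\delta>\beta_i$ (in particular $Q_\delta$ is a key polynomial for $\nu_i$), $\nu_\delta=\nu_i$ for $\delta=\beta_i$ and $\nu_\delta=\nu_{i+1}$ for $\delta=\beta_{i+1}$, and $(\nu_\delta)_{\delta\in\Delta}$, with the key polynomials $Q_\delta$ and the values $\delta$, is a family of augmented iterated valuations. -/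

import Mathlib

open Polynomial
open scoped DirectSum

namespace KeyPoly

universe u v

/-! ### The graded algebra of a valuation -/

section Graded

variable {R : Type u} [CommRing R] {Γ : Type v} [AddCommGroup Γ] [LinearOrder Γ]
  [IsOrderedAddMonoid Γ]

/-- `P_β = {y | μ y ≥ β}`. -/
def filt (μ : AddValuation R (WithTop Γ)) (β : Γ) : AddSubgroup R where
  carrier := {y | (β : WithTop Γ) ≤ μ y}
  zero_mem' := by simp
  add_mem' := fun hx hy => μ.map_le_add hx hy
  neg_mem' := fun {x} hx => by
    change (β : WithTop Γ) ≤ μ (-x)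
    rw [μ.map_neg]; exact hx

/-- `P_{β+} = {y | μ y > β}`. -/
def filtPlus (μ : AddValuation R (WithTop Γ)) (β : Γ) : AddSubgroup R where
  carrier := {y | (β : WithTop Γ) < μ y}
  zero_mem' := by simp
  add_mem' := fun hx hy => μ.map_lt_add hx hy
  neg_mem' := fun {x} hx => by
    change (β : WithTop Γ) < μ (-x)
    rw [μ.map_neg]; exact hx

/-- The homogeneous component `P_β / P_{β+}` of `G_μ`. -/
abbrev GrPiece (μ : AddValuation R (WithTop Γ)) (β : Γ) : Type u :=
  filt μ β ⧸ (filtPlus μ β).addSubgroupOf (filt μ β)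

/-- The class in `P_β / P_{β+}` of an element of `P_β`. -/
def grMk (μ : AddValuation R (WithTop Γ)) (β : Γ) (y : R) (hy : (β : WithTop Γ) ≤ μ y) :
    GrPiece μ β :=
  QuotientAddGroup.mk (⟨y, hy⟩ : filt μ β)

theorem grMk_eq_iff (μ : AddValuation R (WithTop Γ)) {β : Γ} {y z : R}
    (hy : (β : WithTop Γ) ≤ μ y) (hz : (β : WithTop Γ) ≤ μ z) :
    grMk μ β y hy = grMk μ β z hz ↔ (β : WithTop Γ) < μ (z - y) := by
  unfold grMk
  rw [QuotientAddGroup.eq, AddSubgroup.mem_addSubgroupOf]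
  change (β : WithTop Γ) < μ (-y + z) ↔ _
  rw [neg_add_eq_sub]

theorem le_mul_val (μ : AddValuation R (WithTop Γ)) {β γ : Γ} {y z : R}
    (hy : (β : WithTop Γ) ≤ μ y) (hz : (γ : WithTop Γ) ≤ μ z) :
    ((β + γ : Γ) : WithTop Γ) ≤ μ (y * z) := by
  rw [μ.map_mul, WithTop.coe_add]; exact add_le_add hy hz

theorem lt_mul_val (μ : AddValuation R (WithTop Γ)) {β γ : Γ} {y z : R}
    (hy : (β : WithTop Γ) < μ y) (hz : (γ : WithTop Γ) ≤ μ z) :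
    ((β + γ : Γ) : WithTop Γ) < μ (y * z) := by
  rw [μ.map_mul, WithTop.coe_add]
  exact lt_of_lt_of_le (WithTop.add_lt_add_right WithTop.coe_ne_top hy)
    (add_le_add le_rfl hz)

theorem grMk_surj (μ : AddValuation R (WithTop Γ)) {β : Γ} (a : GrPiece μ β) :
    ∃ (y : R) (hy : (β : WithTop Γ) ≤ μ y), grMk μ β y hy = a := by
  induction a using QuotientAddGroup.induction_on with
  | H z => exact ⟨z.1, z.2, rfl⟩

/-- Multiplication `P_β / P_{β+} × P_γ / P_{γ+} → P_{β+γ} / P_{(β+γ)+}` induced by that of `R`. -/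
def grMul (μ : AddValuation R (WithTop Γ)) {β γ : Γ} (a : GrPiece μ β) (b : GrPiece μ γ) :
    GrPiece μ (β + γ) :=
  Quotient.liftOn₂' a b (fun y z => grMk μ (β + γ) (y.1 * z.1) (le_mul_val μ y.2 z.2)) (by
    intro y z y' z' h h'
    have h1 := (grMk_eq_iff μ y.2 y'.2).1 (Quotient.sound' h)
    have h2 := (grMk_eq_iff μ z.2 z'.2).1 (Quotient.sound' h')
    refine (grMk_eq_iff μ _ _).2 ?_
    have e : y'.1 * z'.1 - y.1 * z.1 = (y'.1 - y.1) * z'.1 + (z'.1 - z.1) * y.1 := by ring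
    rw [e]
    refine μ.map_lt_add (lt_mul_val μ h1 z'.2) ?_
    rw [add_comm β γ]
    exact lt_mul_val μ h2 y.2)

theorem grMul_mk (μ : AddValuation R (WithTop Γ)) {β γ : Γ} {y z : R}
    (hy : (β : WithTop Γ) ≤ μ y) (hz : (γ : WithTop Γ) ≤ μ z) :
    grMul μ (grMk μ β y hy) (grMk μ γ z hz) = grMk μ (β + γ) (y * z) (le_mul_val μ hy hz) :=
  rfl

theorem grMk_add (μ : AddValuation R (WithTop Γ)) {β : Γ} {y z : R}
    (hy : (β : WithTop Γ) ≤ μ y) (hz : (β : WithTop Γ) ≤ μ z) :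
    grMk μ β y hy + grMk μ β z hz = grMk μ β (y + z) (μ.map_le_add hy hz) :=
  rfl

theorem grMk_zero (μ : AddValuation R (WithTop Γ)) {β : Γ} :
    grMk μ β 0 (by simp) = 0 :=
  rfl

theorem grMk_congr (μ : AddValuation R (WithTop Γ)) {β γ : Γ} {y z : R}
    (hy : (β : WithTop Γ) ≤ μ y) (hz : (γ : WithTop Γ) ≤ μ z) (h : β = γ) (h' : y = z) :
    GradedMonoid.mk (A := GrPiece μ) β (grMk μ β y hy) =
      GradedMonoid.mk (A := GrPiece μ) γ (grMk μ γ z hz) := by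
  subst h; subst h'; rfl

theorem grMk_ext (μ : AddValuation R (WithTop Γ)) {β : Γ} {y z : R}
    (hy : (β : WithTop Γ) ≤ μ y) (hz : (β : WithTop Γ) ≤ μ z) (h : y = z) :
    grMk μ β y hy = grMk μ β z hz := by
  subst h; rfl

theorem one_val (μ : AddValuation R (WithTop Γ)) : ((0 : Γ) : WithTop Γ) ≤ μ 1 := by simp

theorem natCast_val (μ : AddValuation R (WithTop Γ)) (n : ℕ) :
    ((0 : Γ) : WithTop Γ) ≤ μ (n : R) := by
  induction n with
  | zero => simp
  | succ n ih => push_cast; exact μ.map_le_add ih (one_val μ)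

theorem intCast_val (μ : AddValuation R (WithTop Γ)) (n : ℤ) :
    ((0 : Γ) : WithTop Γ) ≤ μ (n : R) := by
  cases n with
  | ofNat n => simpa using natCast_val μ n
  | negSucc n =>
    rw [Int.cast_negSucc, μ.map_neg]; exact natCast_val μ (n + 1)

instance grGMul (μ : AddValuation R (WithTop Γ)) : GradedMonoid.GMul (GrPiece μ) where
  mul := grMul μ

instance grGOne (μ : AddValuation R (WithTop Γ)) : GradedMonoid.GOne (GrPiece μ) where
  one := grMk μ 0 1 (one_val μ)

instance grMonoid (μ : AddValuation R (WithTop Γ)) : GradedMonoid.GMonoid (GrPiece μ) where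
  one_mul := by
    rintro ⟨i, a⟩
    obtain ⟨y, hy, rfl⟩ := grMk_surj μ a
    exact grMk_congr μ (le_mul_val μ (one_val μ) hy) hy (zero_add i) (one_mul y)
  mul_one := by
    rintro ⟨i, a⟩
    obtain ⟨y, hy, rfl⟩ := grMk_surj μ a
    exact grMk_congr μ (le_mul_val μ hy (one_val μ)) hy (add_zero i) (mul_one y)
  mul_assoc := by
    rintro ⟨i, a⟩ ⟨j, b⟩ ⟨k, c⟩
    obtain ⟨x, hx, rfl⟩ := grMk_surj μ a
    obtain ⟨y, hy, rfl⟩ := grMk_surj μ b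
    obtain ⟨z, hz, rfl⟩ := grMk_surj μ c
    exact grMk_congr μ (le_mul_val μ (le_mul_val μ hx hy) hz)
      (le_mul_val μ hx (le_mul_val μ hy hz)) (add_assoc i j k) (mul_assoc x y z)

instance grCommRing (μ : AddValuation R (WithTop Γ)) : DirectSum.GCommRing (GrPiece μ) where
  __ := grMonoid μ
  mul_zero := by
    intro i j a
    obtain ⟨y, hy, rfl⟩ := grMk_surj μ a
    rw [← grMk_zero, ← grMk_zero]
    exact grMk_ext μ _ _ (mul_zero y)
  zero_mul := by
    intro i j b
    obtain ⟨y, hy, rfl⟩ := grMk_surj μ b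
    rw [← grMk_zero, ← grMk_zero]
    exact grMk_ext μ _ _ (zero_mul y)
  mul_add := by
    intro i j a b c
    obtain ⟨x, hx, rfl⟩ := grMk_surj μ a
    obtain ⟨y, hy, rfl⟩ := grMk_surj μ b
    obtain ⟨z, hz, rfl⟩ := grMk_surj μ c
    exact grMk_ext μ _ _ (mul_add x y z)
  add_mul := by
    intro i j a b c
    obtain ⟨x, hx, rfl⟩ := grMk_surj μ a
    obtain ⟨y, hy, rfl⟩ := grMk_surj μ b
    obtain ⟨z, hz, rfl⟩ := grMk_surj μ c
    exact grMk_ext μ _ _ (add_mul x y z)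
  mul_comm := by
    rintro ⟨i, a⟩ ⟨j, b⟩
    obtain ⟨x, hx, rfl⟩ := grMk_surj μ a
    obtain ⟨y, hy, rfl⟩ := grMk_surj μ b
    exact grMk_congr μ (le_mul_val μ hx hy) (le_mul_val μ hy hx) (add_comm i j) (mul_comm x y)
  natCast n := grMk μ 0 (n : R) (natCast_val μ n)
  natCast_zero := by
    rw [← grMk_zero]
    exact grMk_ext μ _ _ Nat.cast_zero
  natCast_succ n :=
    grMk_ext μ (natCast_val μ (n + 1))
      (μ.map_le_add (natCast_val μ n) (one_val μ)) (Nat.cast_succ n)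
  intCast n := grMk μ 0 (n : R) (intCast_val μ n)
  intCast_ofNat n :=
    grMk_ext μ (intCast_val μ n)
      (natCast_val μ n) (Int.cast_natCast n)
  intCast_negSucc_ofNat n :=
    grMk_ext μ (intCast_val μ (Int.negSucc n))
      (z := -((n + 1 : ℕ) : R)) (by rw [μ.map_neg]; exact natCast_val μ (n + 1))
      (Int.cast_negSucc n)

/-- The graded algebra `G_μ = ⨁_β P_β / P_{β+}`. -/
abbrev Gr (μ : AddValuation R (WithTop Γ)) : Type (max v u) := ⨁ β : Γ, GrPiece μ β

noncomputable instance (μ : AddValuation R (WithTop Γ)) : CommRing (Gr μ) :=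
  DirectSum.commRing (GrPiece μ)

open Classical in
/-- The initial form `in_μ y`: the image of `y` in `P_β / P_{β+}`, `β = μ y`; by convention
`in_μ y = 0` if `μ y = ∞`. -/
noncomputable def initial (μ : AddValuation R (WithTop Γ)) (y : R) : Gr μ :=
  if h : μ y = ⊤ then 0
  else DirectSum.of (GrPiece μ) ((μ y).untop h)
    (grMk μ ((μ y).untop h) y (by rw [WithTop.coe_untop]))

end Graded

variable {K : Type u} [Field K] {Γ : Type v} [AddCommGroup Γ] [LinearOrder Γ]
  [IsOrderedAddMonoid Γ]

/-! ### Vaquié key polynomials and augmented valuations -/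

/-- `f` and `g` are `μ`-equivalent. -/
def ValEquiv (μ : AddValuation K[X] (WithTop Γ)) (f g : K[X]) : Prop :=
  initial μ f = initial μ g

/-- `g` `μ`-divides `f`. -/
def ValDvd (μ : AddValuation K[X] (WithTop Γ)) (g f : K[X]) : Prop :=
  ∃ h : K[X], ValEquiv μ f (h * g)

/-- Vaquié key polynomials: `μ`-minimal, `μ`-irreducible and monic. -/
structure IsVaquieKeyPoly (μ : AddValuation K[X] (WithTop Γ)) (φ : K[X]) : Prop where
  minimal : ∀ f : K[X], f ≠ 0 → ValDvd μ φ f → φ.degree ≤ f.degree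
  irreducible : ∀ f g : K[X], ValDvd μ φ (f * g) → ValDvd μ φ f ∨ ValDvd μ φ g
  monic : φ.Monic

/-- `μ' = [μ ; μ'(φ) = γ]`: `φ` is a key polynomial for `μ`, `γ > μ φ`, and `μ' f` is the minimum of
`μ f_j + j γ` over the terms of the `φ`-adic expansion `f = f_m φ^m + ⋯ + f_0`,
`deg f_j < deg φ`. -/
structure IsAugmentation (μ : AddValuation K[X] (WithTop Γ)) (φ : K[X]) (γ : Γ)
    (μ' : AddValuation K[X] (WithTop Γ)) : Prop where
  degree_pos : 0 < φ.degree
  key : IsVaquieKeyPoly μ φ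
  lt : μ φ < γ
  eq_min : ∀ (m : ℕ) (a : ℕ → K[X]), (∀ j, (a j).degree < φ.degree) →
    μ' (∑ j ∈ Finset.range (m + 1), a j * φ ^ j) =
      (Finset.range (m + 1)).inf fun j => μ (a j) + j • (γ : WithTop Γ)

/-- Families of augmented iterated valuations `(μ_α)_{α ∈ A}`, together with the key polynomials
`φ_α` and the values `γ_α` defining them. -/
def IsAugmentedIteratedFamily {A : Type*} [LinearOrder A]
    (μ : A → AddValuation K[X] (WithTop Γ)) (φ : A → K[X]) (γ : A → Γ) : Prop :=
  ∀ α : A, ¬ IsMin α → ∃ θ < α,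
    IsAugmentation (μ θ) (φ α) (γ α) (μ α) ∧
    (∀ π, π ⋖ α → θ = π ∧
      (¬ IsMin θ → ¬ ValEquiv (μ θ) (φ α) (φ θ) ∧ (φ θ).degree ≤ (φ α).degree)) ∧
    ((¬ ∃ π, π ⋖ α) → ∀ β, θ < β → β < α →
      IsAugmentation (μ θ) (φ β) (γ β) (μ β) ∧
      IsAugmentation (μ β) (φ α) (γ α) (μ α) ∧
      (φ α).degree = (φ β).degree)

/-! ### HOS key polynomials -/

/-- The valuation `ν` of `K` has (archimedean) rank one. -/
def IsRankOne (ν : AddValuation K (WithTop Γ)) : Prop :=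
  (∃ a : K, a ≠ 0 ∧ ν a ≠ 0) ∧
  ∀ a b : K, 0 < ν a → b ≠ 0 → ∃ n : ℕ, ν b ≤ n • ν a

/-- The residue field `k_ν` has characteristic `p`. -/
def ResidueCharP (ν : AddValuation K (WithTop Γ)) (p : ℕ) : Prop :=
  CharP (IsLocalRing.ResidueField (AddValuation.toValuation ν).valuationSubring) p

/-- An index `i < l` is `l`-essential. -/
def IsEssential (α : Ordinal.{0} → ℕ) (l i : Ordinal.{0}) : Prop :=
  i < l ∧ ∃ t : ℕ, 0 < t ∧ (i + t = l ∨ (i + t < l ∧ 1 < α (i + t)))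

open Classical in
/-- `i+`, for `i < l`: it is `i + 1` if `i` is `l`-essential and `i + ω` otherwise. -/
noncomputable def plus (α : Ordinal.{0} → ℕ) (l i : Ordinal.{0}) : Ordinal.{0} :=
  if IsEssential α l i then i + 1 else i + Ordinal.omega0

/-- The multi-index `g = (g_i)_{1 ≤ i < l}` is standard (as an index for `l`-standard monomials
not involving `Q_l`). Indices of key polynomials start at `1`. -/
structure IsStandardIndex (α : Ordinal.{0} → ℕ) (l : Ordinal.{0}) (g : Ordinal.{0} →₀ ℕ) :
    Prop where
  support : ∀ i ∈ g.support, 1 ≤ i ∧ i < l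
  bound : ∀ i, 1 ≤ i → i < l → g i < α (plus α l i)
  inessential : ∀ i, 1 ≤ i → i < l → ¬ IsEssential α l i →
    {j | 1 ≤ j ∧ j < plus α l i ∧ plus α l j = plus α l i ∧ g j ≠ 0}.Subsingleton

/-- The monomial `c * ∏ Q_i ^ g_i`. -/
noncomputable def monom (Q : Ordinal.{0} → K[X]) (c : K) (g : Ordinal.{0} →₀ ℕ) : K[X] :=
  C c * g.prod fun i n => Q i ^ n

/-- The polynomial represented by a finite sum of monomials `s g * ∏ Q_i ^ g_i`. -/
noncomputable def evalSum (Q : Ordinal.{0} → K[X]) (s : (Ordinal.{0} →₀ ℕ) →₀ K) : K[X] :=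
  s.sum fun g c => monom Q c g

open Classical in
/-- The finite sum of monomials `S = ∑_g s g * ∏ Q_i ^ g_i` is an `l`-standard expansion not
involving `Q_l`: all its monomials are `l`-standard and do not involve `Q_l`, and for each value
`β` of a monomial of `S` the initial forms of the monomials of value `β` do not sum to `0`. -/
structure IsStdExpansionNotInvolving (μ : AddValuation K[X] (WithTop Γ)) (Q : Ordinal.{0} → K[X])
    (α : Ordinal.{0} → ℕ) (l : Ordinal.{0}) (s : (Ordinal.{0} →₀ ℕ) →₀ K) : Prop where
  standard : ∀ g ∈ s.support, IsStandardIndex α l g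
  initial_ne : ∀ h ∈ s.support,
    ∑ g ∈ s.support with μ (monom Q (s g) g) = μ (monom Q (s h) h),
      initial μ (monom Q (s g) g) ≠ 0

/-- `h = ∑_{j ≤ n} c_j Q_l ^ j` is an `l`-standard expansion of `h`. -/
def IsStdExpansion (μ : AddValuation K[X] (WithTop Γ)) (Q : Ordinal.{0} → K[X])
    (α : Ordinal.{0} → ℕ) (l : Ordinal.{0}) (h : K[X]) (n : ℕ)
    (c : ℕ → (Ordinal.{0} →₀ ℕ) →₀ K) : Prop :=
  (∀ j, IsStdExpansionNotInvolving μ Q α l (c j)) ∧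
    h = ∑ j ∈ Finset.range (n + 1), evalSum Q (c j) * Q l ^ j

/-- The subalgebra `G_ν[in_μ Q_j : 1 ≤ j < l]` of `G_μ`. -/
noncomputable def initialSubring (μ : AddValuation K[X] (WithTop Γ)) (Q : Ordinal.{0} → K[X])
    (l : Ordinal.{0}) : Subring (Gr μ) :=
  Subring.closure ({y | ∃ a : K, y = initial μ (C a)} ∪
    {y | ∃ j, 1 ≤ j ∧ j < l ∧ y = initial μ (Q j)})

/-- The condition on `Q_i`, `i = l + 1`, relative to its immediate predecessor `l`:
`Q_i = Q_l ^ α_i + ∑_{j < α_i} c_j Q_l ^ j` is an `l`-standard expansion, all its monomials have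
the same value, and taking initial forms of its monomials yields the minimal algebraic relation
satisfied by `in_μ Q_l` over `G_ν[in_μ Q_j : j < l]`. -/
def SuccessorCondition (μ : AddValuation K[X] (WithTop Γ)) (Q : Ordinal.{0} → K[X])
    (α : Ordinal.{0} → ℕ) (l : Ordinal.{0}) : Prop :=
  ∃ c : ℕ → (Ordinal.{0} →₀ ℕ) →₀ K,
    (∀ j, IsStdExpansionNotInvolving μ Q α l (c j)) ∧
    Q (l + 1) = Q l ^ α (l + 1) +
      ∑ j ∈ Finset.range (α (l + 1)), evalSum Q (c j) * Q l ^ j ∧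
    (∀ j < α (l + 1), ∀ g ∈ (c j).support,
      μ (monom Q (c j g) g) + j • μ (Q l) = α (l + 1) • μ (Q l)) ∧
    initial μ (Q l) ^ α (l + 1) +
      ∑ j ∈ Finset.range (α (l + 1)),
        (∑ g ∈ (c j).support, initial μ (monom Q (c j g) g)) * initial μ (Q l) ^ j = 0 ∧
    ∀ P : (Gr μ)[X], P ≠ 0 → (∀ n, P.coeff n ∈ initialSubring μ Q l) →
      P.eval (initial μ (Q l)) = 0 → α (l + 1) ≤ P.natDegree

/-- The condition on `Q_i` when `i` has no immediate predecessor: `char k_ν = p > 0`, there is an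
`i`-inessential index `i₀` with `i = i₀+`, and `Q_i` is a weakly affine monic `i₀`-standard
expansion `c_0 + ∑_{j ≤ e} c_{p^j} Q_{i₀} ^ (p^j)` of degree `α_i = p^e` in `Q_{i₀}`. -/
def LimitCondition (ν : AddValuation K (WithTop Γ)) (μ : AddValuation K[X] (WithTop Γ))
    (Q : Ordinal.{0} → K[X]) (α : Ordinal.{0} → ℕ) (i : Ordinal.{0}) : Prop :=
  ∃ p : ℕ, p.Prime ∧ ResidueCharP ν p ∧
  ∃ i₀ : Ordinal.{0}, 1 ≤ i₀ ∧ i₀ < i ∧ ¬ IsEssential α i i₀ ∧ i = plus α i i₀ ∧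
  ∃ e : ℕ, 0 < e ∧ α i = p ^ e ∧
  ∃ c : ℕ → (Ordinal.{0} →₀ ℕ) →₀ K,
    (∀ q, IsStdExpansionNotInvolving μ Q α i₀ (c q)) ∧
    Q i = evalSum Q (c 0) +
      ∑ j ∈ Finset.range (e + 1), evalSum Q (c (p ^ j)) * Q i₀ ^ p ^ j ∧
    evalSum Q (c (p ^ e)) = 1 ∧
    ∃ β' : Γ, 0 < β' ∧ (∀ q, 1 ≤ q → q < i → μ (Q q) < β') ∧
      p ^ e • (β' : WithTop Γ) ≤ μ (Q i) ∧
      ∀ j ≤ e, evalSum Q (c (p ^ j)) ≠ 0 →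
        p ^ j • (β' : WithTop Γ) + μ (evalSum Q (c (p ^ j))) = p ^ e • (β' : WithTop Γ)

/-- `{Q_i}_{1 ≤ i < L}`, with the positive integers `α_i`, is a set of HOS key polynomials for the
valuation `μ` of `K[X]` extending the valuation `ν` of `K`. -/
structure IsHOSFamily (ν : AddValuation K (WithTop Γ)) (μ : AddValuation K[X] (WithTop Γ))
    (L : Ordinal.{0}) (Q : Ordinal.{0} → K[X]) (α : Ordinal.{0} → ℕ) : Prop where
  first : Q 1 = X
  alpha_one : α 1 = 1
  alpha_pos : ∀ i, 1 ≤ i → i < L → 0 < α i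
  alpha_finite : ∀ l, l < L → {i | 1 ≤ i ∧ i ≤ l ∧ α i ≠ 1}.Finite
  exists_expansion : ∀ i, 1 ≤ i → i < L → ∀ h : K[X], ∃ n c, IsStdExpansion μ Q α i h n c
  successor : ∀ l, 1 ≤ l → l + 1 < L → SuccessorCondition μ Q α l
  limit : ∀ i, i < L → Order.IsSuccLimit i → LimitCondition ν μ Q α i

/-- `w` is the `i`-truncation `ν_i`: `w h = min_j (j β_i + μ d_j)` for each `i`-standard expansion
`h = ∑ d_j Q_i ^ j`, where `β_i = μ Q_i`. -/
def IsTruncation (μ : AddValuation K[X] (WithTop Γ)) (Q : Ordinal.{0} → K[X])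
    (α : Ordinal.{0} → ℕ) (i : Ordinal.{0}) (w : AddValuation K[X] (WithTop Γ)) : Prop :=
  ∀ h n c, IsStdExpansion μ Q α i h n c →
    w h = (Finset.range (n + 1)).inf fun j => j • μ (Q i) + μ (evalSum Q (c j))

/-- `P` is a polynomial `Q_δ = Q_i + z_δ` attached to the value `β`: `z_δ` is an `i`-standard
expansion not involving `Q_i`, `ν_i Q_δ = ν_i Q_i = ν_i z_δ` and `ν_{i+1} Q_δ = β > β_i`. -/
def IsDeltaPoly (μ : AddValuation K[X] (WithTop Γ)) (Q : Ordinal.{0} → K[X])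
    (α : Ordinal.{0} → ℕ) (i : Ordinal.{0}) (νi νi1 : AddValuation K[X] (WithTop Γ))
    (β : Γ) (P : K[X]) : Prop :=
  ∃ s : (Ordinal.{0} →₀ ℕ) →₀ K, IsStdExpansionNotInvolving μ Q α i s ∧
    P = Q i + evalSum Q s ∧ νi P = νi (Q i) ∧ νi (Q i) = νi (evalSum Q s) ∧
    νi1 P = β ∧ μ (Q i) < β

end KeyPoly

/-!
The argument reduces everything to one property of a monic polynomial `R` relative to a valuation
`w` of `K[X]`: `R` is `w`-minimal (`IsMinimalFor`) if `w (a + h R) ≤ w a` whenever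
`deg a < deg R`. In that case `w` is computed by `R`-adic expansions (`map_adic_expansion`), and `w`
is the least valuation with its values below `deg R` and at `R` (`le_of_isMinimalFor`). If
`u ≤ u'` agree below `deg R` and `u R < u' R`, then `R` is `u`-minimal (`isMinimalFor_of_lt`), it is
a key polynomial for `u` (`isVaquieKeyPoly_of_lt`), and `u'` has a truncation at `R`, that is, a
valuation `w` for which `R` is minimal and which equals `u'` below `deg R` and at `R`. Indeed, if
`f g = q R + r` is a division with remainder and `deg f, deg g < deg R`, then
`u' (f g) < u' (q R)` (`productCondition_of_lt`), and this makes the minimum over `R`-adic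
expansions multiplicative (`ProductCondition.exists_isMinimalFor`).

For the key polynomials `Q_l` one first checks that an `l`-standard expansion not involving `Q_l`
has degree less than `deg Q_l` (`IsHOSFamily.degreeData`), so that `l`-standard expansions are
`Q_l`-adic expansions. Transfinite induction then gives the truncation of `μ` at every `Q_l`
(`IsHOSFamily.productCondition`). At a successor `l + 1`, the minimality of the relation defining
`Q_{l+1}` shows that the truncation at `Q_l` agrees with `μ` below `deg Q_{l+1}`, and it is smaller
than `μ` at `Q_{l+1}`. At a limit `i₀ + ω`, the truncations at `Q_{i₀ + n}` play the same role for
large `n`.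

Finally let `deg Q_i = deg Q_{i+1}` and let `v = ν_{i+1}` be the truncation of `μ` at `Q_{i+1}`. All
the polynomials `Q_δ` are monic of degree `deg Q_i` with `v Q_δ = δ`, and `ν_δ` is the truncation
of `v` at `Q_δ`; the endpoints `ν_i`, `ν_{i+1}` are the truncations of `v` at `Q_i` and `Q_{i+1}`.
For `θ < δ` the difference `Q_δ - Q_θ` has degree less than `deg Q_i` and `v`-value `θ`, hence
`ν_θ Q_δ = θ < δ = ν_δ Q_δ`. So `ν_δ` is an augmentation of each earlier `ν_θ`, and `Q_δ`, `Q_θ` are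
not `ν_θ`-equivalent (`IsTruncAt.isAugmentation`). A polynomial attached to `β` is `Q_{i+1} + y`
with `deg y < deg Q_i` and `μ y = β`; such a `y` exists because the values of polynomials of degree
less than `deg Q_i` are closed under addition (`IsTruncAt.exists_degree_lt_val`).
-/

namespace KeyPoly

universe u v

/-! ### Valuations for which a polynomial is minimal -/

section Minimal

variable {K : Type u} [Field K] {Γ : Type v} [AddCommGroup Γ] [LinearOrder Γ]
  [IsOrderedAddMonoid Γ]

/-- `R` is `w`-minimal: no polynomial of degree less than `deg R` is `w`-divisible by `R`. -/
def IsMinimalFor (w : AddValuation K[X] (WithTop Γ)) (R : K[X]) : Prop :=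
  ∀ a h : K[X], a.degree < R.degree → w (a + h * R) ≤ w a

/-- `w` and `w'` take the same values on the polynomials of degree less than `deg R`. -/
def AgreeBelow (w w' : AddValuation K[X] (WithTop Γ)) (R : K[X]) : Prop :=
  ∀ a : K[X], a.degree < R.degree → w a = w' a

theorem exists_div {R : K[X]} (hR : R.Monic) (f : K[X]) :
    ∃ b k : K[X], b.degree < R.degree ∧ f = b + k * R :=
  ⟨f %ₘ R, f /ₘ R, degree_modByMonic_lt f hR, by
    conv_lhs => rw [← modByMonic_add_div f R, mul_comm]⟩

/-- Induction along division by `R`. -/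
theorem adic_induction {R : K[X]} (hR : R.Monic) (hd : 0 < R.degree) {P : K[X] → Prop}
    (h0 : P 0) (hs : ∀ a h : K[X], a.degree < R.degree → P h → P (a + h * R)) (f : K[X]) :
    P f := by
  induction hn : f.natDegree using Nat.strong_induction_on generalizing f with
  | _ n ih =>
    subst hn
    rw [← modByMonic_add_div f R, mul_comm]
    refine hs _ _ (degree_modByMonic_lt _ hR) ?_
    rcases eq_or_ne f 0 with rfl | hf
    · simpa using h0
    · by_cases hlt : f.degree < R.degree
      · rw [(divByMonic_eq_zero_iff hR).2 hlt]; exact h0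
      · refine ih _ ?_ _ rfl
        rw [natDegree_divByMonic _ hR]
        have h1 : 0 < R.natDegree := natDegree_pos_iff_degree_pos.2 hd
        have h2 := natDegree_le_natDegree (not_lt.1 hlt)
        omega

theorem exists_adic_expansion {R : K[X]} (hR : R.Monic) (hd : 0 < R.degree) (f : K[X]) :
    ∃ (m : ℕ) (a : ℕ → K[X]), (∀ j, (a j).degree < R.degree) ∧
      f = ∑ j ∈ Finset.range (m + 1), a j * R ^ j := by
  refine adic_induction hR hd (P := fun f => ∃ (m : ℕ) (a : ℕ → K[X]),
    (∀ j, (a j).degree < R.degree) ∧ f = ∑ j ∈ Finset.range (m + 1), a j * R ^ j) ?_ ?_ f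
  · exact ⟨0, 0, fun j => by simpa using bot_lt_iff_ne_bot.2 (degree_ne_bot.2 hR.ne_zero), by simp⟩
  · rintro a _ ha ⟨m, b, hb, rfl⟩
    refine ⟨m + 1, fun j => Nat.casesOn j a b, fun j => ?_, ?_⟩
    · cases j <;> simp_all
    · rw [Finset.sum_range_succ' _ (m + 1), Finset.sum_mul, add_comm]
      simp only [pow_succ, pow_zero, mul_one, mul_assoc]
      rfl

theorem exists_adic_expansion_of_degree_lt {R : K[X]} (hR : R.Monic) (k : ℕ) (f : K[X])
    (hf : f.degree < (k * R.natDegree : ℕ)) :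
    ∃ a : ℕ → K[X], (∀ j, (a j).degree < R.degree) ∧
      f = ∑ j ∈ Finset.range k, a j * R ^ j := by
  induction k generalizing f with
  | zero =>
    refine ⟨0, fun j => by simpa using bot_lt_iff_ne_bot.2 (degree_ne_bot.2 hR.ne_zero), ?_⟩
    simpa using hf
  | succ k ih =>
    obtain ⟨b, hb, hfb⟩ := ih (f /ₘ R) (by
      by_cases hlt : f.degree < R.degree
      · rw [(divByMonic_eq_zero_iff hR).2 hlt, degree_zero]; exact WithBot.bot_lt_coe _
      · have hf0 : f ≠ 0 := by
          rintro rfl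
          exact hlt (by simpa using bot_lt_iff_ne_bot.2 (degree_ne_bot.2 hR.ne_zero))
        have hq : f /ₘ R ≠ 0 := fun h => hlt ((divByMonic_eq_zero_iff hR).1 h)
        rw [degree_eq_natDegree hf0, Nat.cast_lt] at hf
        rw [degree_eq_natDegree hq, Nat.cast_lt, natDegree_divByMonic _ hR]
        have h2 := natDegree_le_natDegree (not_lt.1 hlt)
        rw [Nat.succ_mul] at hf
        omega)
    refine ⟨fun j => Nat.casesOn j (f %ₘ R) b, fun j => ?_, ?_⟩
    · cases j
      · exact degree_modByMonic_lt _ hR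
      · exact hb _
    · conv_lhs => rw [← modByMonic_add_div f R, hfb, mul_comm]
      rw [Finset.sum_range_succ' _ k, Finset.sum_mul, add_comm, pow_zero, mul_one]
      simp only [pow_succ, mul_assoc]
      rfl

theorem map_add_mul_of_isMinimalFor {w : AddValuation K[X] (WithTop Γ)} {R : K[X]}
    (hw : IsMinimalFor w R) {a : K[X]} (ha : a.degree < R.degree) (h : K[X]) :
    w (a + h * R) = min (w a) (w h + w R) := by
  rw [← w.map_mul]
  refine le_antisymm (le_min (hw a h ha) ?_) (w.map_add _ _)
  calc w (a + h * R) = min (w (a + h * R)) (w a) := (min_eq_left (hw a h ha)).symm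
    _ ≤ w (a + h * R - a) := w.map_sub _ _
    _ = w (h * R) := by rw [add_sub_cancel_left]

theorem map_adic_expansion {w : AddValuation K[X] (WithTop Γ)} {R : K[X]}
    (hw : IsMinimalFor w R) (m : ℕ) (a : ℕ → K[X]) (ha : ∀ j, (a j).degree < R.degree) :
    w (∑ j ∈ Finset.range (m + 1), a j * R ^ j) =
      (Finset.range (m + 1)).inf fun j => w (a j) + j • w R := by
  induction m generalizing a with
  | zero => simp
  | succ m ih =>
    have e : ∑ j ∈ Finset.range (m + 1 + 1), a j * R ^ j =
        a 0 + (∑ j ∈ Finset.range (m + 1), a (j + 1) * R ^ j) * R := by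
      rw [Finset.sum_range_succ' _ (m + 1), Finset.sum_mul, add_comm]
      simp only [pow_succ, pow_zero, mul_one, mul_assoc]
    rw [e, map_add_mul_of_isMinimalFor hw (ha 0), ih _ fun j => ha (j + 1)]
    refine le_antisymm (Finset.le_inf fun j hj => ?_) (le_min ?_ ?_)
    · cases j with
      | zero => simp
      | succ j =>
        refine (min_le_right _ _).trans ?_
        rw [succ_nsmul, ← add_assoc]
        exact add_le_add (Finset.inf_le (by simpa using hj)) le_rfl
    · refine (Finset.inf_le (b := 0) (by simp)).trans ?_
      simp
    · obtain ⟨j, hj, hj'⟩ := Finset.exists_mem_eq_inf (Finset.range (m + 1)) (by simp)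
        fun j => w (a (j + 1)) + j • w R
      rw [hj', add_assoc (w (a (j + 1))), ← succ_nsmul]
      exact Finset.inf_le (f := fun j => w (a j) + j • w R) (b := j + 1) (by simpa using hj)

/-- The least valuation with given values below `deg R` and at `R` is the one for which `R` is
minimal. -/
theorem le_of_isMinimalFor {w w' : AddValuation K[X] (WithTop Γ)} {R : K[X]} (hR : R.Monic)
    (hd : 0 < R.degree) (hw : IsMinimalFor w R) (hww' : AgreeBelow w w' R) (h : w R ≤ w' R)
    (f : K[X]) : w f ≤ w' f := by
  refine adic_induction hR hd (P := fun f => w f ≤ w' f) (by simp) ?_ f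
  intro a g ha hg
  rw [map_add_mul_of_isMinimalFor hw ha]
  refine le_trans ?_ (w'.map_add _ _)
  rw [w'.map_mul, hww' a ha]
  gcongr

/-- If `u ≤ u'` agree below `deg R` and `u R < u' R`, a relation `u (a + h R) > u a` would force
`u' a > u a`. -/
theorem isMinimalFor_of_lt {u u' : AddValuation K[X] (WithTop Γ)} {R : K[X]}
    (hle : ∀ f, u f ≤ u' f) (hag : AgreeBelow u u' R) (h : u R < u' R) : IsMinimalFor u R := by
  intro a g ha
  by_contra! hlt
  have h1 : u (g * R) = u a := by
    have e : g * R = (a + g * R) - a := by ring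
    rw [e]; exact u.map_sub_eq_of_lt_right hlt
  have ha_top : u a ≠ ⊤ := hlt.ne_top
  have h2 : u a < u' (g * R) := by
    rw [u'.map_mul, ← h1, u.map_mul]
    have hg : u g ≠ ⊤ := by
      intro hg; rw [u.map_mul, hg, top_add] at h1; exact ha_top h1.symm
    exact lt_of_lt_of_le (WithTop.add_lt_add_left hg h) (add_le_add (hle g) le_rfl)
  have h3 : u a < u' ((a + g * R) - g * R) :=
    lt_of_lt_of_le (lt_min (lt_of_lt_of_le hlt (hle _)) h2) (u'.map_sub _ _)
  rw [add_sub_cancel_right, ← hag a ha] at h3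
  exact h3.false

/-- If `u`, `u'` agree on `f`, `g` and on the quotient and remainder of `f g` by `R`, and
`u R < u' R`, then the remainder alone carries the initial form of `f g` for `u'`. -/
theorem map_mul_lt_of_lt {u u' : AddValuation K[X] (WithTop Γ)} {R f g q r : K[X]}
    (hf : u f = u' f) (hg : u g = u' g) (hq : u q = u' q) (hr : u r = u' r)
    (e : f * g = q * R + r) (h : u R < u' R) (hq' : u q ≠ ⊤) :
    u' (f * g) < u' q + u' R := by
  by_contra! hle
  have efg : u (f * g) = u' (f * g) := by rw [u.map_mul, u'.map_mul, hf, hg]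
  have h1 : u (q * R) < u' (q * R) := by
    rw [u.map_mul, u'.map_mul, hq]; rw [hq] at hq'; exact WithTop.add_lt_add_left hq' h
  have h2 : u (q * R) < u (f * g) := by
    rw [efg]; refine lt_of_lt_of_le h1 ?_; rwa [u'.map_mul]
  have er : r = f * g - q * R := by rw [e]; ring
  have h3 : u r = u (q * R) := by rw [er]; exact u.map_sub_eq_of_lt_right h2
  have h4 : u (q * R) < u' r := by
    rw [er]
    exact lt_of_lt_of_le (lt_min (by rwa [← efg]) h1) (u'.map_sub _ _)
  rw [← hr, h3] at h4
  exact h4.false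

theorem degree_quotient_lt {R f g q r : K[X]} (hf : f.degree < R.degree)
    (hg : g.degree < R.degree) (hr : r.degree < R.degree) (e : f * g = q * R + r) :
    q.degree < R.degree := by
  rcases eq_or_ne q 0 with rfl | hq
  · rw [degree_zero]; exact lt_of_le_of_lt bot_le hf
  have hR : R ≠ 0 := by rintro rfl; simp at hf
  by_contra! hle
  have hqR : R.degree ≤ (q * R).degree := by
    rw [degree_mul, degree_eq_natDegree hq, degree_eq_natDegree hR]
    norm_cast; omega
  have h1 : (f * g).degree = (q * R).degree := by
    rw [e]; exact degree_add_eq_left_of_degree_lt (lt_of_lt_of_le hr hqR)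
  rw [degree_mul, degree_mul] at h1
  have hfg : f * g ≠ 0 := by
    rw [← degree_ne_bot, degree_mul, h1, ← degree_mul, degree_ne_bot]
    exact mul_ne_zero hq hR
  rw [degree_eq_natDegree hq, degree_eq_natDegree hR] at *
  rw [degree_eq_natDegree (left_ne_zero_of_mul hfg)] at *
  rw [degree_eq_natDegree (right_ne_zero_of_mul hfg)] at *
  norm_cast at *
  omega

/-! ### Construction of the valuation with prescribed value at a polynomial -/

section Construction

variable (u : AddValuation K[X] (WithTop Γ)) (R : K[X])

open Classical in
/-- `min_j (u a_j + j u(R))` for the `R`-adic expansion `∑ a_j R ^ j` of `f`, computed by successive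
divisions by `R`. If `R` is not monic of positive degree, the value is `u f`. -/
noncomputable def adicMin (f : K[X]) : WithTop Γ :=
  if R.Monic ∧ 0 < R.degree ∧ R.degree ≤ f.degree then
    min (u (f %ₘ R)) (adicMin (f /ₘ R) + u R)
  else u f
termination_by f.natDegree
decreasing_by
  rename_i h
  obtain ⟨hR, hd, hle⟩ := h
  rw [natDegree_divByMonic _ hR]
  have h1 : 0 < R.natDegree := natDegree_pos_iff_degree_pos.2 hd
  have h2 := natDegree_le_natDegree hle
  omega

variable {u R}

theorem adicMin_of_degree_lt {f : K[X]} (hf : f.degree < R.degree) : adicMin u R f = u f := by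
  rw [adicMin, if_neg]
  exact fun h => (not_le.2 hf) h.2.2

theorem adicMin_zero (hR : R.Monic) : adicMin u R 0 = ⊤ := by
  rw [adicMin_of_degree_lt, u.map_zero]
  simpa using bot_lt_iff_ne_bot.2 (degree_ne_bot.2 hR.ne_zero)

theorem adicMin_add_mul (hR : R.Monic) (hd : 0 < R.degree) {a : K[X]}
    (ha : a.degree < R.degree) (h : K[X]) :
    adicMin u R (a + h * R) = min (u a) (adicMin u R h + u R) := by
  rcases eq_or_ne h 0 with rfl | hh
  · rw [zero_mul, add_zero, adicMin_zero hR, top_add, min_eq_left le_top, adicMin_of_degree_lt ha]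
  have hdeg : R.degree ≤ (h * R).degree := by
    rw [degree_mul, degree_eq_natDegree hh, degree_eq_natDegree hR.ne_zero]
    norm_cast; omega
  obtain ⟨h1, h2⟩ := div_modByMonic_unique (f := a + h * R) h a hR ⟨by ring, ha⟩
  rw [adicMin, if_pos, h1, h2]
  refine ⟨hR, hd, ?_⟩
  rw [degree_add_eq_right_of_degree_lt (lt_of_lt_of_le ha hdeg)]
  exact hdeg

theorem adicMin_mul_self (hR : R.Monic) (hd : 0 < R.degree) (h : K[X]) :
    adicMin u R (h * R) = adicMin u R h + u R := by
  have := adicMin_add_mul (u := u) hR hd (a := 0)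
    (by simpa using bot_lt_iff_ne_bot.2 (degree_ne_bot.2 hR.ne_zero)) h
  simpa using this

theorem le_adicMin_add (hR : R.Monic) (hd : 0 < R.degree) (f g : K[X]) :
    min (adicMin u R f) (adicMin u R g) ≤ adicMin u R (f + g) := by
  refine adic_induction hR hd (P := fun f => ∀ g,
    min (adicMin u R f) (adicMin u R g) ≤ adicMin u R (f + g)) ?_ ?_ f g
  · intro g; rw [zero_add]; exact min_le_right _ _
  · intro a h ha ih g
    obtain ⟨b, k, hb, rfl⟩ : ∃ b k : K[X], b.degree < R.degree ∧ g = b + k * R := exists_div hR g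
    have e : a + h * R + (b + k * R) = (a + b) + (h + k) * R := by ring
    rw [e, adicMin_add_mul hR hd ha, adicMin_add_mul hR hd hb,
      adicMin_add_mul hR hd (lt_of_le_of_lt (degree_add_le a b) (max_lt ha hb))]
    refine le_min ?_ ?_
    · refine le_trans ?_ (u.map_add a b)
      exact min_le_min (min_le_left _ _) (min_le_left _ _)
    · refine le_trans ?_ (add_le_add (ih k) le_rfl)
      rw [min_add]
      exact min_le_min (min_le_right _ _) (min_le_right _ _)

/-- The remainder of a product of two polynomials of degree less than `deg R` carries its initial
form. This makes `adicMin u R` multiplicative. -/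
def ProductCondition (u : AddValuation K[X] (WithTop Γ)) (R : K[X]) : Prop :=
  ∀ f g q r : K[X], f.degree < R.degree → g.degree < R.degree → q.degree < R.degree →
    r.degree < R.degree → f * g = q * R + r → q ≠ 0 → u (f * g) < u q + u R

theorem ProductCondition.map_remainder (hT : ProductCondition u R) {f g q r : K[X]}
    (hf : f.degree < R.degree) (hg : g.degree < R.degree) (hr : r.degree < R.degree)
    (e : f * g = q * R + r) : u r = u (f * g) := by
  rcases eq_or_ne q 0 with rfl | hq
  · rw [e]; simp
  have h2 : u (f * g) < u (q * R) := by
    rw [u.map_mul q]; exact hT f g q r hf hg (degree_quotient_lt hf hg hr e) hr e hq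
  have er : r = f * g - q * R := by rw [e]; ring
  rw [er]; exact u.map_sub_eq_of_lt_left h2

theorem adicMin_add_mul_le (hR : R.Monic) (hd : 0 < R.degree) {a : K[X]}
    (ha : a.degree < R.degree) (h : K[X]) : adicMin u R (a + h * R) ≤ u a := by
  rw [adicMin_add_mul hR hd ha]; exact min_le_left _ _

theorem ProductCondition.le_adicMin_mul_left (hT : ProductCondition u R) (hR : R.Monic)
    (hd : 0 < R.degree) {a : K[X]} (ha : a.degree < R.degree) (g : K[X]) :
    u a + adicMin u R g ≤ adicMin u R (a * g) := by
  refine adic_induction hR hd (P := fun g => u a + adicMin u R g ≤ adicMin u R (a * g)) ?_ ?_ g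
  · rw [mul_zero, adicMin_zero hR]; exact le_top
  · intro b k hb ih
    obtain ⟨r, q, hr, e⟩ := exists_div hR (a * b)
    have e' : a * b = q * R + r := by rw [e]; ring
    have e2 : a * (b + k * R) = a * b + (a * k) * R := by ring
    rw [e2]
    refine le_trans (le_min ?_ ?_) (le_adicMin_add hR hd _ _)
    · refine (add_le_add le_rfl (adicMin_add_mul_le hR hd hb k)).trans ?_
      rw [← u.map_mul]
      conv_rhs => rw [e]
      rw [adicMin_add_mul hR hd hr, hT.map_remainder ha hb hr e']
      have hq := degree_quotient_lt ha hb hr e'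
      rw [adicMin_of_degree_lt hq]
      refine le_min le_rfl ?_
      rcases eq_or_ne q 0 with rfl | hq0
      · simp
      · exact (hT a b q r ha hb hq hr e' hq0).le
    · rw [adicMin_mul_self hR hd, adicMin_add_mul hR hd hb]
      refine le_trans ?_ (add_le_add ih le_rfl)
      rw [add_assoc]
      exact add_le_add le_rfl (min_le_right _ _)

theorem ProductCondition.le_adicMin_mul (hT : ProductCondition u R) (hR : R.Monic)
    (hd : 0 < R.degree) (f g : K[X]) :
    adicMin u R f + adicMin u R g ≤ adicMin u R (f * g) := by
  refine adic_induction hR hd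
    (P := fun f => adicMin u R f + adicMin u R g ≤ adicMin u R (f * g)) ?_ ?_ f
  · rw [zero_mul, adicMin_zero hR]; exact le_top
  · intro a h ha ih
    have e : (a + h * R) * g = a * g + (h * g) * R := by ring
    rw [e]
    refine le_trans (le_min ?_ ?_) (le_adicMin_add hR hd _ _)
    · exact (add_le_add (adicMin_add_mul_le hR hd ha h) le_rfl).trans
        (hT.le_adicMin_mul_left hR hd ha g)
    · rw [adicMin_mul_self hR hd, adicMin_add_mul hR hd ha]
      refine le_trans ?_ (add_le_add ih le_rfl)
      rw [add_right_comm]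
      exact add_le_add (min_le_right _ _) le_rfl

theorem adicMin_neg (hR : R.Monic) (hd : 0 < R.degree) (f : K[X]) :
    adicMin u R (-f) = adicMin u R f := by
  refine adic_induction hR hd (P := fun f => adicMin u R (-f) = adicMin u R f) (by simp) ?_ f
  intro a h ha ih
  have e : -(a + h * R) = -a + (-h) * R := by ring
  rw [e, adicMin_add_mul hR hd (by rwa [degree_neg]), adicMin_add_mul hR hd ha, ih, u.map_neg]

theorem adicMin_add_of_lt (hR : R.Monic) (hd : 0 < R.degree) {f g : K[X]}
    (h : adicMin u R g < adicMin u R f) : adicMin u R (f + g) = adicMin u R g := by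
  refine le_antisymm ?_ (le_trans (le_min h.le le_rfl) (le_adicMin_add hR hd f g))
  by_contra! hlt
  have h1 := le_adicMin_add (u := u) hR hd (f + g) (-f)
  rw [adicMin_neg hR hd, add_neg_cancel_comm] at h1
  exact absurd h1 (not_le.2 (lt_min hlt h))

theorem ProductCondition.adicMin_mul (hT : ProductCondition u R) (hR : R.Monic)
    (hd : 0 < R.degree) (f g : K[X]) :
    adicMin u R (f * g) = adicMin u R f + adicMin u R g := by
  refine adic_induction hR hd
    (P := fun f => ∀ g, adicMin u R (f * g) = adicMin u R f + adicMin u R g) ?_ ?_ f g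
  · intro g; rw [zero_mul, adicMin_zero hR, top_add]
  intro a f ha ihf g
  refine adic_induction hR hd (P := fun g =>
    adicMin u R ((a + f * R) * g) = adicMin u R (a + f * R) + adicMin u R g) ?_ ?_ g
  · rw [mul_zero, adicMin_zero hR, add_top]
  intro b g hb ihg
  have hge := hT.le_adicMin_mul hR hd (a + f * R) (b + g * R)
  rcases eq_or_ne (adicMin u R (a + f * R)) ⊤ with hF | hF
  · rw [hF, top_add] at hge ⊢; exact top_le_iff.1 hge
  rcases eq_or_ne (adicMin u R (b + g * R)) ⊤ with hG | hG
  · rw [hG, add_top] at hge ⊢; exact top_le_iff.1 hge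
  have hFa := adicMin_add_mul_le (u := u) hR hd ha f
  have hGb := adicMin_add_mul_le (u := u) hR hd hb g
  rcases hFa.lt_or_eq with hFa | hFa
  · -- the minimum for `a + f R` is reached by `f R` only
    have h1 : adicMin u R (a + f * R) = adicMin u R f + u R := by
      rw [adicMin_add_mul hR hd ha] at hFa ⊢
      exact min_eq_right ((min_lt_iff.1 hFa).resolve_left (lt_irrefl _)).le
    have h2 : adicMin u R ((f * (b + g * R)) * R) =
        adicMin u R (a + f * R) + adicMin u R (b + g * R) := by
      rw [adicMin_mul_self hR hd, ihf, h1]; abel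
    have e : (a + f * R) * (b + g * R) = a * (b + g * R) + (f * (b + g * R)) * R := by ring
    rw [e, adicMin_add_of_lt hR hd, h2]
    rw [h2]
    exact lt_of_lt_of_le (WithTop.add_lt_add_right hG hFa) (hT.le_adicMin_mul_left hR hd ha _)
  rcases hGb.lt_or_eq with hGb | hGb
  · -- the minimum for `b + g R` is reached by `g R` only
    have h1 : adicMin u R (b + g * R) = adicMin u R g + u R := by
      rw [adicMin_add_mul hR hd hb] at hGb ⊢
      exact min_eq_right ((min_lt_iff.1 hGb).resolve_left (lt_irrefl _)).le
    have h2 : adicMin u R (((a + f * R) * g) * R) =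
        adicMin u R (a + f * R) + adicMin u R (b + g * R) := by
      rw [adicMin_mul_self hR hd, ihg, h1]; abel
    have e : (a + f * R) * (b + g * R) = b * (a + f * R) + ((a + f * R) * g) * R := by ring
    rw [e, adicMin_add_of_lt hR hd, h2]
    rw [h2, add_comm]
    exact lt_of_lt_of_le (WithTop.add_lt_add_right hF hGb) (hT.le_adicMin_mul_left hR hd hb _)
  · -- both minima are reached by the constant terms
    refine le_antisymm ?_ hge
    obtain ⟨r, q, hr, e⟩ := exists_div hR (a * b)
    have e2 : (a + f * R) * (b + g * R) = r + (q + a * g + f * (b + g * R)) * R := by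
      linear_combination e
    rw [e2]
    refine (adicMin_add_mul_le hR hd hr _).trans ?_
    rw [hT.map_remainder ha hb hr (q := q) (by rw [e]; ring), u.map_mul, hFa, hGb]

/-- The valuation equal to `u` below `deg R` and at `R`, and for which `R` is minimal. -/
theorem ProductCondition.exists_isMinimalFor (hT : ProductCondition u R) (hR : R.Monic)
    (hd : 0 < R.degree) : ∃ w : AddValuation K[X] (WithTop Γ),
      AgreeBelow w u R ∧ w R = u R ∧ IsMinimalFor w R := by
  have h1 : (1 : K[X]).degree < R.degree := by simpa using hd
  refine ⟨AddValuation.of (adicMin u R) (adicMin_zero hR)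
    (by rw [adicMin_of_degree_lt h1, u.map_one]) (le_adicMin_add hR hd)
    (hT.adicMin_mul hR hd), ?_, ?_, ?_⟩
  · intro a ha; exact adicMin_of_degree_lt ha
  · have := adicMin_mul_self (u := u) hR hd 1
    rw [one_mul, adicMin_of_degree_lt h1, u.map_one, zero_add] at this
    exact this
  · intro a h ha
    have e : adicMin u R a = u a := adicMin_of_degree_lt ha
    exact (adicMin_add_mul_le hR hd ha h).trans e.ge

end Construction

/-- If another valuation agrees with `u'` below `deg R` and is smaller at `R`, then `u'` has a
truncation at `R`. -/
theorem productCondition_of_lt {u u' : AddValuation K[X] (WithTop Γ)} {R : K[X]}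
    (htop : ∀ f, u f = ⊤ → f = 0) (hag : AgreeBelow u u' R) (h : u R < u' R) :
    ProductCondition u' R := fun f g q r hf hg hq hr e hq0 =>
  map_mul_lt_of_lt (hag f hf) (hag g hg) (hag q hq) (hag r hr) e h fun h => hq0 (htop q h)

end Minimal

/-! ### Initial forms -/

section InitialForms

variable {R : Type u} [CommRing R] {Γ : Type v} [AddCommGroup Γ] [LinearOrder Γ]
  [IsOrderedAddMonoid Γ] (μ : AddValuation R (WithTop Γ))

theorem initial_of_top {y : R} (h : μ y = ⊤) : initial μ y = 0 := dif_pos h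

theorem initial_of_eq {y : R} {γ : Γ} (h : μ y = γ) :
    initial μ y = DirectSum.of (GrPiece μ) γ (grMk μ γ y h.ge) := by
  have h0 : μ y ≠ ⊤ := by rw [h]; exact WithTop.coe_ne_top
  obtain rfl : (μ y).untop h0 = γ := by rw [← WithTop.coe_inj, WithTop.coe_untop, h]
  rw [initial, dif_neg h0]

theorem grMk_eq_zero_iff {y : R} {γ : Γ} (h : (γ : WithTop Γ) ≤ μ y) :
    grMk μ γ y h = 0 ↔ (γ : WithTop Γ) < μ y := by
  rw [← grMk_zero, grMk_eq_iff, zero_sub, μ.map_neg]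

theorem initial_eq_zero_iff {y : R} : initial μ y = 0 ↔ μ y = ⊤ := by
  refine ⟨fun h => ?_, initial_of_top μ⟩
  by_contra h0
  obtain ⟨γ, hγ⟩ := WithTop.ne_top_iff_exists.1 h0
  rw [initial_of_eq μ hγ.symm, ← map_zero (DirectSum.of (GrPiece μ) γ)] at h
  have := (grMk_eq_zero_iff μ _).1 (DirectSum.of_injective (β := GrPiece μ) γ h)
  exact absurd hγ this.ne

theorem initial_eq_iff {y z : R} (hy : μ y ≠ ⊤) :
    initial μ y = initial μ z ↔ μ y < μ (z - y) := by
  obtain ⟨β, hβ⟩ := WithTop.ne_top_iff_exists.1 hy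
  have key : ∀ h : μ z = β, initial μ y = initial μ z ↔ μ y < μ (z - y) := by
    intro h
    rw [initial_of_eq μ hβ.symm, initial_of_eq μ h,
      (DirectSum.of_injective (β := GrPiece μ) β).eq_iff, grMk_eq_iff, hβ]
  constructor
  · intro h
    by_cases hz : μ z = β
    · exact (key hz).1 h
    · exfalso
      rcases eq_or_ne (μ z) ⊤ with hz' | hz'
      · rw [initial_of_top μ hz', initial_eq_zero_iff] at h
        exact hy h
      · obtain ⟨γ, hγ⟩ := WithTop.ne_top_iff_exists.1 hz'
        have hne : γ ≠ β := by rintro rfl; exact hz hγ.symm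
        have h1 := congrArg (fun x : Gr μ => x β) h
        simp only [initial_of_eq μ hβ.symm, initial_of_eq μ hγ.symm, DirectSum.of_eq_same] at h1
        rw [DirectSum.of_eq_of_ne _ _ _ hne.symm, grMk_eq_zero_iff] at h1
        exact absurd hβ h1.ne
  · intro h
    exact (key (by rw [μ.map_eq_of_lt_sub h, hβ])).2 h

theorem initial_mul (y z : R) : initial μ (y * z) = initial μ y * initial μ z := by
  rcases eq_or_ne (μ y) ⊤ with hy | hy
  · rw [initial_of_top μ hy, initial_of_top μ (by rw [μ.map_mul, hy, top_add]), zero_mul]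
  rcases eq_or_ne (μ z) ⊤ with hz | hz
  · rw [initial_of_top μ hz, initial_of_top μ (by rw [μ.map_mul, hz, add_top]), mul_zero]
  obtain ⟨β, hβ⟩ := WithTop.ne_top_iff_exists.1 hy
  obtain ⟨γ, hγ⟩ := WithTop.ne_top_iff_exists.1 hz
  have h : μ (y * z) = ((β + γ : Γ) : WithTop Γ) := by
    rw [μ.map_mul, WithTop.coe_add, hβ, hγ]
  rw [initial_of_eq μ h, initial_of_eq μ hβ.symm, initial_of_eq μ hγ.symm, DirectSum.of_mul_of]
  rfl

theorem initial_one : initial μ (1 : R) = 1 :=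
  initial_of_eq μ (γ := 0) (by simp)

theorem initial_pow (y : R) (n : ℕ) : initial μ (y ^ n) = initial μ y ^ n := by
  induction n with
  | zero => simp [initial_one]
  | succ n ih => rw [pow_succ, pow_succ, initial_mul, ih]

theorem sum_initial {ι : Type*} (s : Finset ι) (y : ι → R) (γ : Γ)
    (h : ∀ k ∈ s, μ (y k) = γ) :
    ∑ k ∈ s, initial μ (y k) = DirectSum.of (GrPiece μ) γ
      (grMk μ γ (∑ k ∈ s, y k) (μ.map_le_sum fun k hk => (h k hk).ge)) := by
  classical
  induction s using Finset.induction_on with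
  | empty =>
    simp only [Finset.sum_empty]
    rw [grMk_zero, map_zero]
  | insert a s ha ih =>
    rw [Finset.sum_insert ha, ih fun k hk => h k (Finset.mem_insert_of_mem hk),
      initial_of_eq μ (h a (Finset.mem_insert_self a s)), ← map_add, grMk_add]
    congr 1
    exact grMk_ext μ _ _ (Finset.sum_insert ha).symm

/-- The initial forms of elements of the same value sum to `0` exactly when the value of the sum
is larger. -/
theorem sum_initial_eq_zero_iff {ι : Type*} {s : Finset ι} {y : ι → R} {γ : Γ}
    (h : ∀ k ∈ s, μ (y k) = γ) :
    ∑ k ∈ s, initial μ (y k) = 0 ↔ (γ : WithTop Γ) < μ (∑ k ∈ s, y k) := by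
  rw [sum_initial μ s y γ h, ← map_zero (DirectSum.of (GrPiece μ) γ),
    (DirectSum.of_injective (β := GrPiece μ) γ).eq_iff, grMk_eq_zero_iff]

theorem initial_sum {ι : Type*} {s : Finset ι} {y : ι → R} {γ : Γ}
    (h : ∀ k ∈ s, μ (y k) = γ) (h' : μ (∑ k ∈ s, y k) = γ) :
    initial μ (∑ k ∈ s, y k) = ∑ k ∈ s, initial μ (y k) := by
  rw [sum_initial μ s y γ h, initial_of_eq μ h']

end InitialForms

/-! ### Augmentations -/

section Augmentation

variable {K : Type u} [Field K] {Γ : Type v} [AddCommGroup Γ] [LinearOrder Γ]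
  [IsOrderedAddMonoid Γ]

theorem valDvd_iff {u : AddValuation K[X] (WithTop Γ)} {R f : K[X]} (hf : u f ≠ ⊤) :
    ValDvd u R f ↔ ∃ h, u f < u (f - h * R) := by
  unfold ValDvd ValEquiv
  simp_rw [initial_eq_iff u hf, u.map_sub_swap f]

/-- Minimality of `R` is the hypothesis `hmin`. For irreducibility, a product of the remainders of
`f` and `g` by `R` has, by the product condition for `u'`, a remainder of the same value, so that
`R` cannot divide it. -/
theorem isVaquieKeyPoly_of_lt {u u' : AddValuation K[X] (WithTop Γ)} {R : K[X]} (hR : R.Monic)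
    (htop : ∀ f, u f = ⊤ → f = 0) (hmin : IsMinimalFor u R) (hag : AgreeBelow u u' R)
    (h : u R < u' R) : IsVaquieKeyPoly u R where
  monic := hR
  minimal f hf hdvd := by
    obtain ⟨g, hg⟩ := (valDvd_iff fun h => hf (htop f h)).1 hdvd
    by_contra! hlt
    refine absurd (hmin f (-g) hlt) (not_le.2 ?_)
    rwa [neg_mul, ← sub_eq_add_neg]
  irreducible f g hdvd := by
    have htriv : ∀ f, u f = ⊤ → ValDvd u R f := fun f hf => by
      obtain rfl := htop f hf
      exact ⟨0, by rw [zero_mul]; rfl⟩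
    rcases eq_or_ne (u f) ⊤ with hf | hf
    · exact Or.inl (htriv f hf)
    rcases eq_or_ne (u g) ⊤ with hg | hg
    · exact Or.inr (htriv g hg)
    obtain ⟨p, hp⟩ := (valDvd_iff (by rw [u.map_mul]; simp [hf, hg])).1 hdvd
    rw [valDvd_iff hf, valDvd_iff hg]
    by_contra! hcon
    obtain ⟨hcf, hcg⟩ := hcon
    obtain ⟨a, s, ha, rfl⟩ := exists_div hR f
    obtain ⟨b, t, hb, rfl⟩ := exists_div hR g
    have hfa : u (a + s * R) = u a :=
      le_antisymm (hmin a s ha) (by simpa using hcf s)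
    have hgb : u (b + t * R) = u b :=
      le_antisymm (hmin b t hb) (by simpa using hcg t)
    obtain ⟨r, q, hr, e⟩ := exists_div hR (a * b)
    have e1 : u (r + (q + a * t + s * (b + t * R) - p) * R) ≤ u r := hmin r _ hr
    have e2 : (a + s * R) * (b + t * R) - p * R =
        r + (q + a * t + s * (b + t * R) - p) * R := by linear_combination e
    rw [← e2] at e1
    have hT := productCondition_of_lt htop hag h
    have h1 := hT.map_remainder ha hb hr (q := q) (by rw [e]; ring)
    rw [u'.map_mul, ← hag a ha, ← hag b hb, ← hag r hr] at h1
    rw [h1] at e1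
    refine absurd hp (not_lt.2 (e1.trans_eq ?_))
    rw [u.map_mul, hfa, hgb]

theorem isAugmentation_of_lt {u w : AddValuation K[X] (WithTop Γ)} {R : K[X]} {γ : Γ}
    (hR : R.Monic) (hd : 0 < R.degree) (htop : ∀ f, u f = ⊤ → f = 0) (hmin : IsMinimalFor u R)
    (hag : AgreeBelow u w R) (hlt : u R < w R) (hw : IsMinimalFor w R) (hγ : w R = γ) :
    IsAugmentation u R γ w where
  degree_pos := hd
  key := isVaquieKeyPoly_of_lt hR htop hmin hag hlt
  lt := hγ ▸ hlt
  eq_min m a ha := by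
    rw [map_adic_expansion hw m a ha, hγ]
    exact Finset.inf_congr rfl fun j _ => by rw [hag _ (ha j)]

end Augmentation

/-! ### Standard indices -/

section Standard

variable {K : Type u} [Field K] {Γ : Type v} [AddCommGroup Γ] [LinearOrder Γ]
  [IsOrderedAddMonoid Γ]

theorem exists_nat_of_lt_add_omega0 {k l : Ordinal.{0}} (h : l < k + Ordinal.omega0) :
    ∃ n : ℕ, l ≤ k + n := by
  obtain ⟨d, hd, hle⟩ := (Ordinal.lt_add_iff Ordinal.omega0_ne_zero).1 h
  obtain ⟨n, rfl⟩ := Ordinal.lt_omega0.1 hd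
  exact ⟨n, hle⟩

theorem isSuccLimit_add_omega0 (k : Ordinal.{0}) : Order.IsSuccLimit (k + Ordinal.omega0) :=
  Ordinal.isSuccLimit_add k Ordinal.isSuccLimit_omega0

theorem add_nat_lt_add_omega0 (k : Ordinal.{0}) (n : ℕ) : k + n < k + Ordinal.omega0 :=
  (add_lt_add_iff_left k).2 (Ordinal.natCast_lt_omega0 n)

theorem add_nat_add_omega0 (k : Ordinal.{0}) (n : ℕ) :
    k + n + Ordinal.omega0 = k + Ordinal.omega0 := by
  rw [add_assoc, Ordinal.natCast_add_omega0]

theorem exists_eq_add_nat {k m : Ordinal.{0}} {t : ℕ} (h : k < m) (h' : m ≤ k + t) :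
    ∃ s : ℕ, 0 < s ∧ s ≤ t ∧ m = k + s := by
  have e : k + (m - k) = m := Ordinal.add_sub_cancel_of_le h.le
  have h1 : m - k ≤ t := by rw [← e] at h'; exact (add_le_add_iff_left k).1 h'
  obtain ⟨s, hs⟩ := Ordinal.lt_omega0.1 (lt_of_le_of_lt h1 (Ordinal.natCast_lt_omega0 t))
  rw [hs] at e h1
  refine ⟨s, ?_, by exact_mod_cast h1, e.symm⟩
  rcases Nat.eq_zero_or_pos s with rfl | hs0
  · simp at e; exact absurd e h.ne
  · exact hs0

theorem plus_of_not_isEssential {α : Ordinal.{0} → ℕ} {l k : Ordinal.{0}}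
    (h : ¬ IsEssential α l k) : plus α l k = k + Ordinal.omega0 := if_neg h

theorem plus_of_isEssential {α : Ordinal.{0} → ℕ} {l k : Ordinal.{0}}
    (h : IsEssential α l k) : plus α l k = k + 1 := if_pos h

theorem add_omega0_le_of_not_isEssential {α : Ordinal.{0} → ℕ} {l k : Ordinal.{0}} (hk : k < l)
    (h : ¬ IsEssential α l k) : k + Ordinal.omega0 ≤ l := by
  by_contra! hlt
  obtain ⟨n, hn⟩ := exists_nat_of_lt_add_omega0 hlt
  obtain ⟨s, hs, -, rfl⟩ := exists_eq_add_nat hk hn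
  exact h ⟨hk, s, hs, Or.inl rfl⟩

theorem plus_le {α : Ordinal.{0} → ℕ} {l k : Ordinal.{0}} (hk : k < l) : plus α l k ≤ l := by
  by_cases h : IsEssential α l k
  · rw [plus_of_isEssential h]; exact Order.add_one_le_of_lt hk
  · rw [plus_of_not_isEssential h]; exact add_omega0_le_of_not_isEssential hk h

theorem lt_plus (α : Ordinal.{0} → ℕ) (l k : Ordinal.{0}) : k < plus α l k := by
  by_cases h : IsEssential α l k
  · rw [plus_of_isEssential h]; exact lt_add_one k
  · rw [plus_of_not_isEssential h]; simp

/-- For indices `k < m` of a standard monomial, being essential does not depend on whether the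
monomial is cut off at `m` or at `l`. -/
theorem IsStandardIndex.isEssential_iff {α : Ordinal.{0} → ℕ} {l m k : Ordinal.{0}}
    {g : Ordinal.{0} →₀ ℕ} (hg : IsStandardIndex α l g) (hk : k ∈ g.support) (hm : m ∈ g.support)
    (hkm : k < m) : IsEssential α m k ↔ IsEssential α l k := by
  have hml := (hg.support m hm).2
  constructor
  · rintro ⟨-, t, ht, rfl | ⟨h1, h2⟩⟩
    · by_contra hcon
      have h3 : ¬ IsEssential α l (k + t) := by
        rintro ⟨-, s, hs, h | ⟨h, h'⟩⟩
        · refine hcon ⟨hkm.trans hml, t + s, by omega, Or.inl ?_⟩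
          rw [← h]; push_cast; rw [add_assoc]
        · refine hcon ⟨hkm.trans hml, t + s, by omega, Or.inr ?_⟩
          push_cast; rw [← add_assoc]; exact ⟨h, h'⟩
      have h4 : plus α l (k + t) = plus α l k := by
        rw [plus_of_not_isEssential h3, plus_of_not_isEssential hcon, add_nat_add_omega0]
      -- two inessential indices with the same successor cannot both occur in `g`
      refine hkm.ne (hg.inessential k (hg.support k hk).1 (hkm.trans hml) hcon
        ⟨(hg.support k hk).1, lt_plus α l k, rfl, Finsupp.mem_support_iff.1 hk⟩
        ⟨(hg.support _ hm).1, ?_, h4, Finsupp.mem_support_iff.1 hm⟩)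
      rw [← h4]; exact lt_plus α l _
    · exact ⟨hkm.trans hml, t, ht, Or.inr ⟨h1.trans hml, h2⟩⟩
  · rintro ⟨-, t, ht, h⟩
    by_cases htm : k + t < m
    · rcases h with rfl | ⟨-, h2⟩
      · exact absurd htm hml.not_gt
      · exact ⟨hkm, t, ht, Or.inr ⟨htm, h2⟩⟩
    · obtain ⟨s, hs, -, e⟩ := exists_eq_add_nat hkm (not_lt.1 htm)
      exact ⟨hkm, s, hs, Or.inl e.symm⟩

theorem IsStandardIndex.plus_eq {α : Ordinal.{0} → ℕ} {l m k : Ordinal.{0}}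
    {g : Ordinal.{0} →₀ ℕ} (hg : IsStandardIndex α l g) (hk : k ∈ g.support) (hm : m ∈ g.support)
    (hkm : k < m) : plus α m k = plus α l k := by
  unfold plus
  classical
  exact if_congr (hg.isEssential_iff hk hm hkm) rfl rfl

/-- Removing the largest index `m` of an `l`-standard monomial leaves an `m`-standard one. -/
theorem IsStandardIndex.erase_max {α : Ordinal.{0} → ℕ} {l m : Ordinal.{0}}
    {g : Ordinal.{0} →₀ ℕ} (hα : ∀ i, 1 ≤ i → i ≤ l → 0 < α i) (hg : IsStandardIndex α l g)
    (hm : m ∈ g.support) (hmax : ∀ k ∈ g.support, k ≤ m) : IsStandardIndex α m (g.erase m) := by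
  have hml := (hg.support m hm).2
  have hlt : ∀ k, g.erase m k ≠ 0 → k ∈ g.support ∧ k < m ∧ g.erase m k = g k := by
    intro k hk
    have hkm : k ≠ m := by rintro rfl; simp at hk
    rw [Finsupp.erase_ne hkm] at hk
    have := Finsupp.mem_support_iff.2 hk
    exact ⟨this, lt_of_le_of_ne (hmax k this) hkm, Finsupp.erase_ne hkm⟩
  refine ⟨fun k hk => ?_, fun k hk hkm => ?_, fun k hk hkm hess => ?_⟩
  · obtain ⟨h1, h2, -⟩ := hlt k (Finsupp.mem_support_iff.1 hk)
    exact ⟨(hg.support k h1).1, h2⟩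
  · by_cases h0 : g.erase m k = 0
    · rw [h0]
      exact hα _ (hk.trans (lt_plus α m k).le) ((plus_le hkm).trans hml.le)
    · obtain ⟨h1, h2, h3⟩ := hlt k h0
      rw [h3, hg.plus_eq h1 hm h2]
      exact hg.bound k hk (h2.trans hml)
  · rintro j ⟨hj1, hjlt, hj, hj0⟩ j' ⟨hj1', hjlt', hj', hj0'⟩
    obtain ⟨h1, h2, -⟩ := hlt j hj0
    obtain ⟨h1', h2', -⟩ := hlt j' hj0'
    rw [plus_of_not_isEssential hess] at hj hj'
    rw [hg.plus_eq h1 hm h2] at hj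
    rw [hg.plus_eq h1' hm h2'] at hj'
    have hjess : ¬ IsEssential α l j := by
      intro h
      rw [plus_of_isEssential h] at hj
      exact (isSuccLimit_add_omega0 k).succ_ne j (by rw [← hj, Order.succ_eq_add_one])
    refine hg.inessential j hj1 (h2.trans hml) hjess
      ⟨hj1, lt_plus α l j, rfl, Finsupp.mem_support_iff.1 h1⟩
      ⟨hj1', ?_, hj'.trans hj.symm, Finsupp.mem_support_iff.1 h1'⟩
    rw [hj, ← hj']; exact lt_plus α l j'

/-! ### Degrees of the key polynomials -/

theorem degree_mul_pow_lt {R e : K[X]} (hR : R.Monic) (he : e.degree < R.degree) {j a : ℕ}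
    (hj : j < a) : (e * R ^ j).degree < (a * R.natDegree : ℕ) := by
  rw [degree_mul, degree_pow]
  rw [degree_eq_natDegree hR.ne_zero] at *
  rcases eq_or_ne e 0 with rfl | h0
  · rw [degree_zero, WithBot.bot_add]; exact WithBot.bot_lt_coe _
  rw [degree_eq_natDegree h0] at *
  simp only [nsmul_eq_mul]
  norm_cast at *
  nlinarith

theorem degree_sum_lt_nat {ι : Type*} {s : Finset ι} {f : ι → K[X]} {n : ℕ}
    (h : ∀ k ∈ s, (f k).degree < n) : (∑ k ∈ s, f k).degree < n := by
  rw [← mem_degreeLT]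
  exact Submodule.sum_mem _ fun k hk => mem_degreeLT.2 (h k hk)

theorem monic_pow_add {R z : K[X]} (hR : R.Monic) {a : ℕ}
    (hz : z.degree < (a * R.natDegree : ℕ)) :
    (R ^ a + z).Monic ∧ (R ^ a + z).natDegree = a * R.natDegree := by
  have hdeg : (R ^ a).degree = (a * R.natDegree : ℕ) := by
    rw [degree_eq_natDegree (hR.pow a).ne_zero, natDegree_pow]
  rw [← hdeg] at hz
  exact ⟨(hR.pow a).add_of_left hz, by
    rw [natDegree_add_eq_left_of_degree_lt hz, natDegree_pow]⟩

/-- The shape of a key polynomial of limit index. -/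
theorem monic_of_weaklyAffine {R : K[X]} (hR : R.Monic) {c : ℕ → K[X]}
    (hc : ∀ j, (c j).degree < R.degree) {p e : ℕ} (hp : p.Prime) (htop : c (p ^ e) = 1) :
    (c 0 + ∑ j ∈ Finset.range (e + 1), c (p ^ j) * R ^ p ^ j).Monic ∧
      (c 0 + ∑ j ∈ Finset.range (e + 1), c (p ^ j) * R ^ p ^ j).natDegree =
        p ^ e * R.natDegree := by
  rw [Finset.sum_range_succ, htop, one_mul, ← add_assoc, add_comm]
  refine monic_pow_add hR (lt_of_le_of_lt (degree_add_le _ _)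
    (max_lt ?_ (degree_sum_lt_nat fun j hj => ?_)))
  · simpa using degree_mul_pow_lt hR (hc 0) (pow_pos hp.pos e)
  · exact degree_mul_pow_lt hR (hc _) (Nat.pow_lt_pow_right hp.one_lt (Finset.mem_range.1 hj))

theorem degree_evalSum_lt {Q : Ordinal.{0} → K[X]} {s : (Ordinal.{0} →₀ ℕ) →₀ K} {d : ℕ}
    (h : ∀ g ∈ s.support, (g.sum fun k n => n * (Q k).natDegree) < d) :
    (evalSum Q s).degree < d := by
  refine degree_sum_lt_nat fun g hg => ?_
  refine lt_of_le_of_lt degree_le_natDegree (Nat.cast_lt.2 (lt_of_le_of_lt ?_ (h g hg)))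
  unfold monom
  refine (natDegree_C_mul_le _ _).trans ((natDegree_prod_le _ _).trans ?_)
  exact Finset.sum_le_sum fun k _ => natDegree_pow_le

/-- The degree properties of the `l`-th key polynomial. They compare it with the key polynomials of
earlier index, and with the `l`-standard monomials not involving it. -/
structure DegreeData (Q : Ordinal.{0} → K[X]) (α : Ordinal.{0} → ℕ) (l : Ordinal.{0}) :
    Prop where
  monic : (Q l).Monic
  pos : 0 < (Q l).natDegree
  mono : ∀ k, 1 ≤ k → k ≤ l → (Q k).natDegree ≤ (Q l).natDegree
  mul_le : ∀ m, 1 ≤ m → l = m + 1 ∨ l = m + Ordinal.omega0 →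
    α l * (Q m).natDegree ≤ (Q l).natDegree
  succ_eq : ∀ m, 1 ≤ m → l = m + 1 → (Q l).natDegree = α l * (Q m).natDegree
  standard_lt : ∀ g, IsStandardIndex α l g →
    (g.sum fun k n => n * (Q k).natDegree) < (Q l).natDegree

/-- If `m` is the largest index of `g`, the other factors have total degree less than `deg Q_m`,
so that the whole monomial has degree less than `(g_m + 1) deg Q_m ≤ α_{m+} deg Q_m ≤ deg Q_l`. -/
theorem sum_natDegree_lt_of_standard {Q : Ordinal.{0} → K[X]} {α : Ordinal.{0} → ℕ}
    {l : Ordinal.{0}} (hα : ∀ i, 1 ≤ i → i ≤ l → 0 < α i)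
    (ih : ∀ k, 1 ≤ k → k < l → DegreeData Q α k) (hpos : 0 < (Q l).natDegree)
    (hmono : ∀ k, 1 ≤ k → k ≤ l → (Q k).natDegree ≤ (Q l).natDegree)
    (hmul : ∀ m, 1 ≤ m → l = m + 1 ∨ l = m + Ordinal.omega0 →
      α l * (Q m).natDegree ≤ (Q l).natDegree)
    {g : Ordinal.{0} →₀ ℕ} (hg : IsStandardIndex α l g) :
    (g.sum fun k n => n * (Q k).natDegree) < (Q l).natDegree := by
  rcases eq_or_ne g 0 with rfl | hg0
  · simpa using hpos
  have hne : g.support.Nonempty := Finsupp.support_nonempty_iff.2 hg0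
  set m := g.support.max' hne with hmdef
  have hm : m ∈ g.support := Finset.max'_mem _ _
  obtain ⟨h1m, hml⟩ := hg.support m hm
  have hst := (ih m h1m hml).standard_lt _
    (hg.erase_max hα hm fun k hk => Finset.le_max' _ k hk)
  rw [← Finsupp.add_sum_erase' g m (fun k n => n * (Q k).natDegree) (by simp)]
  have hb : g m + 1 ≤ α (plus α l m) := hg.bound m h1m hml
  have hstep : α (plus α l m) * (Q m).natDegree ≤ (Q l).natDegree := by
    have hor : plus α l m = m + 1 ∨ plus α l m = m + Ordinal.omega0 := by
      by_cases h : IsEssential α l m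
      · exact Or.inl (plus_of_isEssential h)
      · exact Or.inr (plus_of_not_isEssential h)
    have h1p : 1 ≤ plus α l m := h1m.trans (lt_plus α l m).le
    rcases (plus_le (α := α) hml).eq_or_lt with h | h
    · rw [h] at hor ⊢; exact hmul m h1m hor
    · exact ((ih _ h1p h).mul_le m h1m hor).trans (hmono _ h1p h.le)
  calc g m * (Q m).natDegree + _ < g m * (Q m).natDegree + (Q m).natDegree := by gcongr
    _ = (g m + 1) * (Q m).natDegree := by ring
    _ ≤ α (plus α l m) * (Q m).natDegree := by gcongr
    _ ≤ _ := hstep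

section Family

variable {ν : AddValuation K (WithTop Γ)} {μ : AddValuation K[X] (WithTop Γ)}
  {L : Ordinal.{0}} {Q : Ordinal.{0} → K[X]} {α : Ordinal.{0} → ℕ}

theorem DegreeData.degree_lt {l : Ordinal.{0}} (h : DegreeData Q α l)
    {s : (Ordinal.{0} →₀ ℕ) →₀ K} (hs : IsStdExpansionNotInvolving μ Q α l s) :
    (evalSum Q s).degree < (Q l).degree := by
  rw [degree_eq_natDegree h.monic.ne_zero]
  exact degree_evalSum_lt fun g hg => h.standard_lt g (hs.standard g hg)

theorem IsHOSFamily.degreeData (hQ : IsHOSFamily ν μ L Q α) (l : Ordinal.{0}) (h1 : 1 ≤ l)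
    (hL : l < L) : DegreeData Q α l := by
  induction l using WellFoundedLT.induction with
  | _ l ih =>
  replace ih : ∀ k, 1 ≤ k → k < l → DegreeData Q α k := fun k hk hkl => ih k hkl hk (hkl.trans hL)
  have hα : ∀ i, 1 ≤ i → i ≤ l → 0 < α i := fun i hi hil => hQ.alpha_pos i hi (hil.trans_lt hL)
  suffices h : (Q l).Monic ∧ 0 < (Q l).natDegree ∧
      (∀ k, 1 ≤ k → k ≤ l → (Q k).natDegree ≤ (Q l).natDegree) ∧
      (∀ m, 1 ≤ m → l = m + 1 ∨ l = m + Ordinal.omega0 →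
        α l * (Q m).natDegree ≤ (Q l).natDegree) ∧
      (∀ m, 1 ≤ m → l = m + 1 → (Q l).natDegree = α l * (Q m).natDegree) by
    obtain ⟨a, b, c, d, e⟩ := h
    exact ⟨a, b, c, d, e, fun g hg => sum_natDegree_lt_of_standard hα ih b c d hg⟩
  rcases Ordinal.zero_or_succ_or_isSuccLimit l with rfl | ⟨m, rfl⟩ | hlim
  · simp at h1
  · simp only [Order.succ_eq_add_one] at *
    have hmlt : m < m + 1 := lt_add_one m
    rcases eq_zero_or_pos m with rfl | hm
    · rw [zero_add] at *
      refine ⟨hQ.first ▸ monic_X, by rw [hQ.first]; simp, ?_, ?_, ?_⟩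
      · intro k hk hk'; rw [le_antisymm hk' hk]
      · intro m hm h
        exfalso
        rcases h with h | h
        · exact absurd (h.ge.trans_lt' (lt_add_one m)) hm.not_gt
        · have h2 := add_nat_lt_add_omega0 m 0
          rw [← h, Nat.cast_zero, add_zero] at h2
          exact absurd h2 hm.not_gt
      · intro m hm h
        exact absurd (h.ge.trans_lt' (lt_add_one m)) hm.not_gt
    have hm1 : 1 ≤ m := Order.one_le_iff_pos.2 hm
    have hD := ih m hm1 hmlt
    obtain ⟨c, hc, hQe, -⟩ := hQ.successor m hm1 hL
    have hz : (∑ j ∈ Finset.range (α (m + 1)), evalSum Q (c j) * Q m ^ j).degree <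
        (α (m + 1) * (Q m).natDegree : ℕ) := degree_sum_lt_nat fun j hj =>
      degree_mul_pow_lt hD.monic (hD.degree_lt (hc j)) (Finset.mem_range.1 hj)
    obtain ⟨hmon, hdeg⟩ := monic_pow_add hD.monic hz
    rw [← hQe] at hmon hdeg
    have hαp := hα (m + 1) h1 le_rfl
    have hle : (Q m).natDegree ≤ (Q (m + 1)).natDegree := by
      rw [hdeg]; exact Nat.le_mul_of_pos_left _ hαp
    have hsucc : ∀ k, m + 1 = k + 1 → k = m := fun k h => by
      rw [← Order.succ_eq_add_one, ← Order.succ_eq_add_one] at h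
      exact (Order.succ_injective h).symm
    refine ⟨hmon, hD.pos.trans_le hle, ?_, ?_, ?_⟩
    · intro k hk hkm
      rcases hkm.eq_or_lt with rfl | hkm
      · rfl
      · exact (hD.mono k hk (Order.lt_add_one_iff.1 hkm)).trans hle
    · rintro k hk (h | h)
      · rw [hsucc k h, hdeg]
      · exfalso
        refine (isSuccLimit_add_omega0 k).succ_ne m ?_
        rw [← h, Order.succ_eq_add_one]
    · intro k hk h; rw [hsucc k h, hdeg]
  · obtain ⟨p, hp, -, i₀, hi₀, hi₀l, hess, hplus, e, he, hαe, c, hc, hQe, htop, -⟩ :=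
      hQ.limit l hL hlim
    rw [plus_of_not_isEssential hess] at hplus
    have hD := ih i₀ hi₀ hi₀l
    obtain ⟨hmon, hdeg⟩ := monic_of_weaklyAffine hD.monic (c := fun j => evalSum Q (c j))
      (fun j => hD.degree_lt (hc j)) hp htop
    rw [← hQe, ← hαe] at hdeg
    rw [← hQe] at hmon
    -- between `i₀` and `l = i₀ + ω` the degree is constant
    have hconst : ∀ n : ℕ, (Q (i₀ + n)).natDegree = (Q i₀).natDegree := by
      intro n
      induction n with
      | zero => simp
      | succ n ihn =>
        have hlt : i₀ + (n + 1 : ℕ) < l := by rw [hplus]; exact add_nat_lt_add_omega0 i₀ (n + 1)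
        have hα1 : α (i₀ + (n + 1 : ℕ)) = 1 := by
          refine le_antisymm ?_ (hα _ (hi₀.trans le_self_add) hlt.le)
          by_contra! h
          exact hess ⟨hi₀l, n + 1, Nat.succ_pos n, Or.inr ⟨hlt, h⟩⟩
        rw [(ih _ (hi₀.trans le_self_add) hlt).succ_eq (i₀ + n) (hi₀.trans le_self_add)
          (by push_cast; rw [add_assoc]), hα1, one_mul, ihn]
    have hle : ∀ k, 1 ≤ k → k < l → (Q k).natDegree ≤ (Q i₀).natDegree := by
      intro k hk hkl
      rw [hplus] at hkl
      obtain ⟨n, hn⟩ := exists_nat_of_lt_add_omega0 hkl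
      rw [← hconst n]
      refine (ih _ (hi₀.trans le_self_add) ?_).mono k hk hn
      rw [hplus]; exact add_nat_lt_add_omega0 i₀ n
    have hle' : (Q i₀).natDegree ≤ (Q l).natDegree := by
      rw [hdeg]; exact Nat.le_mul_of_pos_left _ (hα l h1 le_rfl)
    refine ⟨hmon, hD.pos.trans_le hle', ?_, ?_, ?_⟩
    · intro k hk hkl
      rcases hkl.eq_or_lt with rfl | hkl
      · rfl
      · exact (hle k hk hkl).trans hle'
    · intro m hm h
      have hml : m < l := by
        rcases h with rfl | rfl
        · exact lt_add_one m
        · simp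
      rw [hdeg]
      exact Nat.mul_le_mul_left _ (hle m hm hml)
    · rintro m hm rfl
      exact absurd (Order.succ_eq_add_one m) (hlim.succ_ne m)

end Family

end Standard

/-! ### Values and initial forms of standard expansions -/

section Truncation

variable {K : Type u} [Field K] {Γ : Type v} [AddCommGroup Γ] [LinearOrder Γ]
  [IsOrderedAddMonoid Γ]

section Family

variable {ν : AddValuation K (WithTop Γ)} {μ : AddValuation K[X] (WithTop Γ)}
  {L : Ordinal.{0}} {Q : Ordinal.{0} → K[X]} {α : Ordinal.{0} → ℕ} {l : Ordinal.{0}}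
  {s : (Ordinal.{0} →₀ ℕ) →₀ K}

open Classical in
/-- There is no cancellation in a standard expansion: its value is the least value of its
monomials, and its initial form is the sum of the initial forms of the monomials of that value. -/
theorem IsStdExpansionNotInvolving.exists_val (hs : IsStdExpansionNotInvolving μ Q α l s)
    (h0 : s ≠ 0) : ∃ β : Γ, μ (evalSum Q s) = β ∧
      (∀ g ∈ s.support, (β : WithTop Γ) ≤ μ (monom Q (s g) g)) ∧
      initial μ (evalSum Q s) = ∑ g ∈ s.support with μ (monom Q (s g) g) = β,
        initial μ (monom Q (s g) g) := by
  obtain ⟨h, hh, hmin⟩ := Finset.exists_min_image s.support (fun g => μ (monom Q (s g) g))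
    (Finsupp.support_nonempty_iff.2 h0)
  have hne := hs.initial_ne h hh
  have htop : μ (monom Q (s h) h) ≠ ⊤ := by
    intro htop
    refine hne (Finset.sum_eq_zero fun g hg => ?_)
    rw [initial_of_top]
    rw [(Finset.mem_filter.1 hg).2, htop]
  obtain ⟨β, hβ⟩ := WithTop.ne_top_iff_exists.1 htop
  rw [← hβ] at hne hmin
  have hval : ∀ g ∈ s.support.filter (fun g => μ (monom Q (s g) g) = β),
      μ (monom Q (s g) g) = β := fun g hg => (Finset.mem_filter.1 hg).2
  rw [Ne, sum_initial_eq_zero_iff μ hval, not_lt] at hne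
  have h1 := le_antisymm hne (μ.map_le_sum fun g hg => (hval g hg).ge)
  have h2 : (β : WithTop Γ) <
      μ (∑ g ∈ s.support with ¬ μ (monom Q (s g) g) = β, monom Q (s g) g) := by
    refine μ.map_lt_sum WithTop.coe_ne_top fun g hg => ?_
    obtain ⟨hg1, hg2⟩ := Finset.mem_filter.1 hg
    exact lt_of_le_of_ne (hmin g hg1) (Ne.symm hg2)
  have e : evalSum Q s = (∑ g ∈ s.support with μ (monom Q (s g) g) = β, monom Q (s g) g) +
      ∑ g ∈ s.support with ¬ μ (monom Q (s g) g) = β, monom Q (s g) g :=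
    (Finset.sum_filter_add_sum_filter_not _ _ _).symm
  have h3 : μ (evalSum Q s) = β := by
    rw [e, μ.map_add_eq_of_lt_left (by rwa [h1]), h1]
  refine ⟨β, h3, hmin, ?_⟩
  rw [← initial_sum μ hval h1, initial_eq_iff μ (by rw [h3]; exact WithTop.coe_ne_top),
    μ.map_sub_swap, h3, e, add_sub_cancel_left]
  exact h2

theorem IsStdExpansionNotInvolving.val_le (hs : IsStdExpansionNotInvolving μ Q α l s)
    {g : Ordinal.{0} →₀ ℕ} (hg : g ∈ s.support) : μ (evalSum Q s) ≤ μ (monom Q (s g) g) := by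
  obtain ⟨β, h1, h2, -⟩ := hs.exists_val (by rintro rfl; simp at hg)
  rw [h1]; exact h2 g hg

theorem initial_monom_mem {g : Ordinal.{0} →₀ ℕ} (hg : ∀ k ∈ g.support, 1 ≤ k ∧ k < l) (c : K) :
    initial μ (monom Q c g) ∈ initialSubring μ Q l := by
  rw [monom, initial_mul]
  refine mul_mem (Subring.subset_closure (Or.inl ⟨c, rfl⟩)) ?_
  refine Finset.prod_induction _ (fun y : K[X] => initial μ y ∈ initialSubring μ Q l) ?_ ?_ ?_
  · intro a b ha hb; rw [initial_mul]; exact mul_mem ha hb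
  · rw [initial_one]; exact one_mem _
  · intro k hk
    change initial μ (Q k ^ g k) ∈ initialSubring μ Q l
    have hmem : initial μ (Q k) ∈ initialSubring μ Q l :=
      Subring.subset_closure (Or.inr ⟨k, (hg k hk).1, (hg k hk).2, rfl⟩)
    rw [initial_pow]
    exact pow_mem hmem _

theorem IsStdExpansionNotInvolving.initial_mem (hs : IsStdExpansionNotInvolving μ Q α l s) :
    initial μ (evalSum Q s) ∈ initialSubring μ Q l := by
  rcases eq_or_ne s 0 with rfl | h0
  · rw [initial_of_top μ (by simp [evalSum])]; exact zero_mem _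
  obtain ⟨β, -, -, h⟩ := hs.exists_val h0
  rw [h]
  refine sum_mem fun g hg => initial_monom_mem ?_ _
  exact (hs.standard g (Finset.mem_filter.1 hg).1).support

/-- By degrees, the `l`-standard expansion of a polynomial of degree less than `deg Q_l` is reduced
to its constant term. -/
theorem IsHOSFamily.exists_std_of_degree_lt (hQ : IsHOSFamily ν μ L Q α) (h1 : 1 ≤ l)
    (hL : l < L) {f : K[X]} (hf : f.degree < (Q l).degree) :
    ∃ s, IsStdExpansionNotInvolving μ Q α l s ∧ evalSum Q s = f := by
  obtain ⟨n, c, hc, e⟩ := hQ.exists_expansion l h1 hL f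
  have hD := hQ.degreeData l h1 hL
  refine ⟨c 0, hc 0, ?_⟩
  rw [Finset.sum_range_succ', pow_zero, mul_one] at e
  have e2 : ∑ j ∈ Finset.range n, evalSum Q (c (j + 1)) * Q l ^ (j + 1) =
      (∑ j ∈ Finset.range n, evalSum Q (c (j + 1)) * Q l ^ j) * Q l := by
    rw [Finset.sum_mul]; simp only [pow_succ, mul_assoc]
  rw [e2] at e
  obtain ⟨-, h2⟩ := div_modByMonic_unique (f := f) _ (evalSum Q (c 0)) hD.monic
    ⟨by rw [mul_comm, add_comm]; exact e.symm, hD.degree_lt (hc 0)⟩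
  rw [← h2]
  exact (modByMonic_eq_self_iff hD.monic).2 hf

/-! ### Truncations -/

/-- `w` is the truncation of `μ` at `R`: the valuation equal to `μ` below `deg R` and at `R`, for
which `R` is minimal. -/
structure IsTruncAt (μ : AddValuation K[X] (WithTop Γ)) (R : K[X])
    (w : AddValuation K[X] (WithTop Γ)) : Prop where
  agree : AgreeBelow w μ R
  self : w R = μ R
  minimal : IsMinimalFor w R

theorem IsTruncAt.le {R : K[X]} {w : AddValuation K[X] (WithTop Γ)} (h : IsTruncAt μ R w)
    (hR : R.Monic) (hd : 0 < R.degree) (f : K[X]) : w f ≤ μ f :=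
  le_of_isMinimalFor hR hd h.minimal h.agree h.self.le f

/-- The `R`-adic expansion of a monic polynomial of degree `k deg R` has leading term `R ^ k`. -/
theorem IsTruncAt.le_of_monic {R f : K[X]} {w : AddValuation K[X] (WithTop Γ)}
    (h : IsTruncAt μ R w) (hR : R.Monic) (hd : 0 < R.degree) (hf : f.Monic) {k : ℕ}
    (hk : f.natDegree = k * R.natDegree) : w f ≤ k • μ R := by
  have hlt : (f - R ^ k).degree < (k * R.natDegree : ℕ) := by
    rw [← hk, ← degree_eq_natDegree hf.ne_zero]
    refine degree_sub_lt_left ?_ hf.ne_zero ?_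
    · rw [degree_eq_natDegree hf.ne_zero, degree_eq_natDegree (hR.pow k).ne_zero, hk, natDegree_pow]
    · rw [hf.leadingCoeff, (hR.pow k).leadingCoeff]
  obtain ⟨a, ha, e⟩ := exists_adic_expansion_of_degree_lt hR k _ hlt
  have h1 : (1 : K[X]).degree < R.degree := by simpa using hd
  have e2 : f = ∑ j ∈ Finset.range (k + 1), (if j < k then a j else 1) * R ^ j := by
    rw [Finset.sum_range_succ, if_neg (lt_irrefl k), one_mul, ← sub_eq_iff_eq_add, e]
    exact Finset.sum_congr rfl fun j hj => by rw [if_pos (Finset.mem_range.1 hj)]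
  rw [e2, map_adic_expansion h.minimal k _ fun j => by split_ifs; exacts [ha j, h1], h.self]
  refine (Finset.inf_le (b := k) (by simp)).trans ?_
  simp

theorem DegreeData.degree_pos (h : DegreeData Q α l) : 0 < (Q l).degree :=
  natDegree_pos_iff_degree_pos.1 h.pos

open Classical in
/-- The minimality of the relation defining `Q_{l+1}` prevents cancellation among the terms of a
`Q_l`-adic expansion of degree less than `α_{l+1}`. -/
theorem IsHOSFamily.agreeBelow_succ (hQ : IsHOSFamily ν μ L Q α) (h1 : 1 ≤ l)
    (hL : l + 1 < L) {w : AddValuation K[X] (WithTop Γ)}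
    (hw : IsTruncAt μ (Q l) w) : AgreeBelow w μ (Q (l + 1)) := by
  intro f hf
  have hlL : l < L := (lt_add_one l).trans hL
  have hD := hQ.degreeData l h1 hlL
  have hD' := hQ.degreeData (l + 1) (h1.trans (lt_add_one l).le) hL
  rw [degree_eq_natDegree hD'.monic.ne_zero, hD'.succ_eq l h1 rfl] at hf
  obtain ⟨a, ha, e⟩ := exists_adic_expansion_of_degree_lt hD.monic _ _ hf
  refine le_antisymm (hw.le hD.monic hD.degree_pos f) (not_lt.1 fun hlt => ?_)
  obtain ⟨γ, hγ⟩ := WithTop.ne_top_iff_exists.1 hlt.ne_top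
  rw [← hγ] at hlt
  have hval : ∀ j, μ (a j) + j • μ (Q l) = μ (a j * Q l ^ j) := fun j => by
    rw [μ.map_mul, μ.map_pow]
  have hα : 0 < α (l + 1) := hQ.alpha_pos _ (h1.trans (lt_add_one l).le) hL
  have hinf : (γ : WithTop Γ) =
      (Finset.range (α (l + 1))).inf fun j => μ (a j * Q l ^ j) := by
    obtain ⟨m, hm⟩ : ∃ m, α (l + 1) = m + 1 := ⟨_, (Nat.succ_pred_eq_of_pos hα).symm⟩
    rw [hm] at e ⊢
    rw [hγ, e, map_adic_expansion hw.minimal m a ha, hw.self]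
    exact Finset.inf_congr rfl fun j _ => by rw [hw.agree _ (ha j), hval]
  set M := (Finset.range (α (l + 1))).filter fun j => μ (a j * Q l ^ j) = γ with hM
  have hMval : ∀ j ∈ M, μ (a j * Q l ^ j) = γ := fun j hj => (Finset.mem_filter.1 hj).2
  have hsum : (γ : WithTop Γ) < μ (∑ j ∈ M, a j * Q l ^ j) := by
    have e3 : ∑ j ∈ M, a j * Q l ^ j =
        f - ∑ j ∈ Finset.range (α (l + 1)) with ¬ μ (a j * Q l ^ j) = γ, a j * Q l ^ j := by
      rw [e, ← Finset.sum_filter_add_sum_filter_not (Finset.range (α (l + 1)))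
        (fun j => μ (a j * Q l ^ j) = γ), add_sub_cancel_right]
    rw [e3]
    refine lt_of_lt_of_le (lt_min hlt (μ.map_lt_sum WithTop.coe_ne_top fun j hj => ?_))
      (μ.map_sub _ _)
    obtain ⟨hj1, hj2⟩ := Finset.mem_filter.1 hj
    refine lt_of_le_of_ne ?_ (Ne.symm hj2)
    rw [hinf]; exact Finset.inf_le hj1
  rw [← sum_initial_eq_zero_iff μ hMval] at hsum
  obtain ⟨j₀, hj₀, hj₀'⟩ := Finset.exists_mem_eq_inf (Finset.range (α (l + 1)))
    (by simpa using hα.ne') fun j => μ (a j * Q l ^ j)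
  have hj₀M : j₀ ∈ M := Finset.mem_filter.2 ⟨hj₀, by rw [hinf, hj₀']⟩
  set P : (Gr μ)[X] := ∑ j ∈ M, C (initial μ (a j)) * X ^ j with hP
  have hcoeff : ∀ n, P.coeff n = if n ∈ M then initial μ (a n) else 0 := by
    intro n
    simp only [hP, finsetSum_coeff, coeff_C_mul, coeff_X_pow, mul_ite, mul_one, mul_zero]
    rw [Finset.sum_ite_eq]
  obtain ⟨-, -, -, -, -, hmin⟩ := hQ.successor l h1 hL
  refine absurd (hmin P ?_ ?_ ?_) (not_le.2 ?_)
  · intro h0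
    have := hcoeff j₀
    rw [h0, coeff_zero, if_pos hj₀M, eq_comm, initial_eq_zero_iff] at this
    have h2 := hMval j₀ hj₀M
    rw [μ.map_mul, this, top_add] at h2
    exact WithTop.top_ne_coe h2
  · intro n
    rw [hcoeff]
    split_ifs
    · obtain ⟨s, hs, hse⟩ := hQ.exists_std_of_degree_lt h1 hlL (ha n)
      rw [← hse]; exact hs.initial_mem
    · exact zero_mem _
  · rw [hP, eval_finsetSum, ← hsum]
    exact Finset.sum_congr rfl fun j _ => by
      rw [eval_mul, eval_C, eval_pow, eval_X, initial_mul, initial_pow]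
  · refine lt_of_le_of_lt (natDegree_sum_le_of_forall_le M _ (n := α (l + 1) - 1) fun j hj => ?_)
      (Nat.sub_lt hα one_pos)
    refine (natDegree_C_mul_X_pow_le _ _).trans ?_
    have := Finset.mem_range.1 (Finset.mem_filter.1 hj).1
    omega

/-- The initial forms of the monomials of `Q_{l+1}`, all of value `α_{l+1} β_l`, sum to `0`. -/
theorem IsHOSFamily.nsmul_lt_succ (hQ : IsHOSFamily ν μ L Q α) (hμ : ∀ f, μ f = ⊤ → f = 0)
    (h1 : 1 ≤ l) (hL : l + 1 < L) : α (l + 1) • μ (Q l) < μ (Q (l + 1)) := by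
  have hD := hQ.degreeData l h1 ((lt_add_one l).trans hL)
  obtain ⟨c, hc, hQe, hval, hrel, -⟩ := hQ.successor l h1 hL
  obtain ⟨β, hβ⟩ := WithTop.ne_top_iff_exists.1 fun h => hD.monic.ne_zero (hμ _ h)
  let y : Option (Σ _ : ℕ, Ordinal.{0} →₀ ℕ) → K[X] := fun o =>
    o.elim (Q l ^ α (l + 1)) fun x => monom Q (c x.1 x.2) x.2 * Q l ^ x.1
  let S : Finset (Option (Σ _ : ℕ, Ordinal.{0} →₀ ℕ)) :=
    Finset.insertNone ((Finset.range (α (l + 1))).sigma fun j => (c j).support)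
  have hy : ∀ o ∈ S, μ (y o) = ((α (l + 1) • β : Γ) : WithTop Γ) := by
    rintro (_ | ⟨j, g⟩) ho
    · change μ (Q l ^ α (l + 1)) = _
      rw [μ.map_pow, ← hβ, WithTop.coe_nsmul]
    · have hmem := Finset.mem_sigma.1 (Finset.some_mem_insertNone.1 ho)
      change μ (monom Q (c j g) g * Q l ^ j) = _
      rw [μ.map_mul, μ.map_pow, hval j (Finset.mem_range.1 hmem.1) g hmem.2, ← hβ,
        WithTop.coe_nsmul]
  have hsum : ∑ o ∈ S, y o = Q (l + 1) := by
    rw [Finset.sum_insertNone, hQe, Finset.sum_sigma]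
    congr 1
    refine Finset.sum_congr rfl fun j _ => ?_
    rw [evalSum, Finsupp.sum, Finset.sum_mul]
    rfl
  have h0 : ∑ o ∈ S, initial μ (y o) = 0 := by
    rw [← hrel, Finset.sum_insertNone, Finset.sum_sigma]
    congr 1
    · exact initial_pow μ _ _
    refine Finset.sum_congr rfl fun j _ => ?_
    rw [Finset.sum_mul]
    refine Finset.sum_congr rfl fun g _ => ?_
    change initial μ (monom Q (c j g) g * Q l ^ j) = _
    rw [initial_mul, initial_pow]
  rw [sum_initial_eq_zero_iff μ hy, hsum] at h0
  rwa [← hβ, ← WithTop.coe_nsmul]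

/-- Among key polynomials of the same degree the values increase. -/
theorem IsHOSFamily.val_le_of_natDegree_eq (hQ : IsHOSFamily ν μ L Q α)
    (hμ : ∀ f, μ f = ⊤ → f = 0) (hL : l < L) {k : Ordinal.{0}} (h1 : 1 ≤ k) (hkl : k ≤ l)
    (hd : (Q k).natDegree = (Q l).natDegree) : μ (Q k) ≤ μ (Q l) := by
  induction l using WellFoundedLT.induction with
  | _ l ih =>
  rcases hkl.eq_or_lt with rfl | hlt
  · rfl
  rcases Ordinal.zero_or_succ_or_isSuccLimit l with rfl | ⟨m, rfl⟩ | hlim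
  · exact absurd hlt (not_lt.2 (zero_le))
  · simp only [Order.succ_eq_add_one] at *
    have hkm : k ≤ m := Order.lt_add_one_iff.1 hlt
    have hmlt : m < m + 1 := lt_add_one m
    have hm1 := h1.trans hkm
    have hD := hQ.degreeData m hm1 (hmlt.trans hL)
    have hD' := hQ.degreeData (m + 1) (hm1.trans hmlt.le) hL
    have hkm' := hD.mono k h1 hkm
    have hs := hD'.succ_eq m hm1 rfl
    have hα := hQ.alpha_pos _ (hm1.trans hmlt.le) hL
    have hpos := hD.pos
    have hα1 : α (m + 1) = 1 := by nlinarith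
    rw [hα1, one_mul] at hs
    refine (ih m hmlt (hmlt.trans hL) hkm (hd.trans hs)).trans ?_
    have := hQ.nsmul_lt_succ hμ hm1 hL
    rw [hα1, one_nsmul] at this
    exact this.le
  · obtain ⟨p, hp, -, i₀, -, -, -, -, e, -, -, c, -, -, -, β', hβ', hlt', hle, -⟩ :=
      hQ.limit l hL hlim
    refine (hlt' k h1 hlt).le.trans (le_trans ?_ hle)
    rw [← WithTop.coe_nsmul]
    exact WithTop.coe_le_coe.2 (le_self_nsmul hβ'.le (pow_pos hp.pos e).ne')

/-- A truncation at `Q_l` keeps the values of all earlier key polynomials, those of the same degree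
as `Q_l` included. -/
theorem IsTruncAt.map_earlier (hQ : IsHOSFamily ν μ L Q α)
    (hμ : ∀ f, μ f = ⊤ → f = 0) (hL : l < L) {k : Ordinal.{0}} (h1 : 1 ≤ k) (hkl : k ≤ l)
    {w : AddValuation K[X] (WithTop Γ)} (hw : IsTruncAt μ (Q l) w) : w (Q k) = μ (Q k) := by
  have hD := hQ.degreeData l (h1.trans hkl) hL
  have hDk := hQ.degreeData k h1 (hkl.trans_lt hL)
  rcases (hD.mono k h1 hkl).lt_or_eq with hlt | heq
  · exact hw.agree _ (degree_lt_degree hlt)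
  refine le_antisymm (hw.le hD.monic hD.degree_pos _) ?_
  have hdeg : (Q k - Q l).degree < (Q l).degree := by
    have h : (Q k).degree = (Q l).degree := by
      rw [degree_eq_natDegree hDk.monic.ne_zero, degree_eq_natDegree hD.monic.ne_zero, heq]
    rw [← h]
    exact degree_sub_lt_left h hDk.monic.ne_zero (by
      rw [hDk.monic.leadingCoeff, hD.monic.leadingCoeff])
  have e : Q k = (Q k - Q l) + 1 * Q l := by ring
  have hle := hQ.val_le_of_natDegree_eq hμ hL h1 hkl heq
  conv_rhs => rw [e]
  rw [map_add_mul_of_isMinimalFor hw.minimal hdeg, w.map_one, zero_add, hw.self, hw.agree _ hdeg]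
  exact le_min (le_trans (le_min le_rfl hle) (μ.map_sub _ _)) hle

/-- Below a limit index `i₀ + ω` every polynomial of small degree involves only finitely many key
polynomials, so that the truncations at `Q_{i₀ + n}` eventually compute its value. -/
theorem IsHOSFamily.eventually_agree (hQ : IsHOSFamily ν μ L Q α)
    (hμ : ∀ f, μ f = ⊤ → f = 0) {i₀ : Ordinal.{0}} (h1 : 1 ≤ i₀)
    (hL : i₀ + Ordinal.omega0 < L) {f : K[X]}
    (hf : f.degree < (Q (i₀ + Ordinal.omega0)).degree) :
    ∃ n₀ : ℕ, ∀ n ≥ n₀, ∀ w, IsTruncAt μ (Q (i₀ + n)) w → w f = μ f := by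
  classical
  obtain ⟨s, hs, rfl⟩ := hQ.exists_std_of_degree_lt (h1.trans le_self_add) hL hf
  have hfin : ∀ k ∈ s.support.biUnion fun g => g.support,
      ∃ n : ℕ, k ≤ i₀ + n := by
    intro k hk
    obtain ⟨g, hg, hk⟩ := Finset.mem_biUnion.1 hk
    exact exists_nat_of_lt_add_omega0 ((hs.standard g hg).support k hk).2
  choose! N hN using hfin
  refine ⟨(s.support.biUnion fun g => g.support).sup N, fun n hn w hw => ?_⟩
  have hnL : i₀ + n < L := (add_nat_lt_add_omega0 i₀ n).trans hL
  have hD := hQ.degreeData _ (h1.trans le_self_add) hnL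
  refine le_antisymm (hw.le hD.monic hD.degree_pos _) (w.map_le_sum fun g hg => ?_)
  refine (hs.val_le hg).trans (le_of_eq ?_)
  change _ = w (monom Q (s g) g)
  rw [monom, μ.map_mul, w.map_mul, hw.agree (C (s g)) (lt_of_le_of_lt degree_C_le hD.degree_pos)]
  congr 1
  refine Finset.prod_induction _ (fun y => μ y = w y) ?_ ?_ ?_
  · intro a b ha hb; rw [μ.map_mul, w.map_mul, ha, hb]
  · rw [μ.map_one, w.map_one]
  · intro k hk
    have hk' : k ∈ s.support.biUnion fun g => g.support := Finset.mem_biUnion.2 ⟨g, hg, hk⟩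
    have hkn : k ≤ i₀ + n := (hN k hk').trans
      ((add_le_add_iff_left i₀).2 (by exact_mod_cast (Finset.le_sup hk').trans hn))
    rw [μ.map_pow, w.map_pow, hw.map_earlier hQ hμ hnL ((hs.standard g hg).support k hk).1 hkn]

theorem ProductCondition.exists_isTruncAt {R : K[X]} (hT : ProductCondition μ R) (hR : R.Monic)
    (hd : 0 < R.degree) : ∃ w, IsTruncAt μ R w := by
  obtain ⟨w, a, b, c⟩ := hT.exists_isMinimalFor hR hd
  exact ⟨w, a, b, c⟩

/-- Every key polynomial admits a truncation. At a successor index the truncation at the previous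
key polynomial is an approximation of `μ` good enough to compare values; at a limit index the
truncation at a late enough earlier key polynomial is. -/
theorem IsHOSFamily.productCondition (hQ : IsHOSFamily ν μ L Q α)
    (hμ : ∀ f, μ f = ⊤ → f = 0) (h1 : 1 ≤ l) (hL : l < L) : ProductCondition μ (Q l) := by
  induction l using WellFoundedLT.induction with
  | _ l ih =>
  have hD := hQ.degreeData l h1 hL
  have htrunc : ∀ k, 1 ≤ k → k < l → ∃ w, IsTruncAt μ (Q k) w := fun k hk hkl =>
    have hDk := hQ.degreeData k hk (hkl.trans hL)
    (ih k hkl hk (hkl.trans hL)).exists_isTruncAt hDk.monic hDk.degree_pos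
  have hwtop : ∀ k, 1 ≤ k → k < l → ∀ w, IsTruncAt μ (Q k) w → ∀ f, w f = ⊤ → f = 0 := by
    intro k hk hkl w hw f hf
    have hDk := hQ.degreeData k hk (hkl.trans hL)
    exact hμ f (top_le_iff.1 (hf ▸ hw.le hDk.monic hDk.degree_pos f))
  rcases Ordinal.zero_or_succ_or_isSuccLimit l with rfl | ⟨m, rfl⟩ | hlim
  · simp at h1
  · simp only [Order.succ_eq_add_one] at *
    have hmlt : m < m + 1 := lt_add_one m
    rcases eq_zero_or_pos m with rfl | hm
    · intro f g q r hf hg hq hr e hq0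
      exfalso
      rw [zero_add, hQ.first, degree_X] at hf hg hq hr
      have hC : ∀ {f : K[X]}, f.degree < 1 → f = C (f.coeff 0) := fun hf =>
        eq_C_of_degree_le_zero (Nat.WithBot.lt_one_iff_le_zero.1 hf)
      rw [zero_add, hQ.first, hC hf, hC hg, hC hq, hC hr, ← C_mul] at e
      have := congrArg (fun p => coeff p 1) e
      simp only [coeff_add, coeff_C_mul, coeff_X_one, coeff_C_of_ne_zero one_ne_zero, mul_one,
        add_zero] at this
      exact hq0 (by rw [hC hq, ← this, C_0])
    have hm1 : 1 ≤ m := Order.one_le_iff_pos.2 hm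
    have hDm := hQ.degreeData m hm1 (hmlt.trans hL)
    obtain ⟨w, hw⟩ := htrunc m hm1 hmlt
    refine productCondition_of_lt (hwtop m hm1 hmlt w hw) (hQ.agreeBelow_succ hm1 hL hw) ?_
    exact lt_of_le_of_lt (hw.le_of_monic hDm.monic hDm.degree_pos hD.monic (hD.succ_eq m hm1 rfl))
      (hQ.nsmul_lt_succ hμ hm1 hL)
  · obtain ⟨p, hp, -, i₀, hi₀, hi₀l, hess, hplus, e, he, hαe, c, hc, hQe, htop, β', hβ', hlt',
      hle, -⟩ := hQ.limit l hL hlim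
    rw [plus_of_not_isEssential hess] at hplus
    subst hplus
    intro f g q r hf hg hq hr e' hq0
    obtain ⟨n1, hn1⟩ := hQ.eventually_agree hμ hi₀ hL hf
    obtain ⟨n2, hn2⟩ := hQ.eventually_agree hμ hi₀ hL hg
    obtain ⟨n3, hn3⟩ := hQ.eventually_agree hμ hi₀ hL hq
    obtain ⟨n4, hn4⟩ := hQ.eventually_agree hμ hi₀ hL hr
    set n := n1 + n2 + n3 + n4
    have hnl := add_nat_lt_add_omega0 i₀ n
    have hn : (1 : Ordinal.{0}) ≤ i₀ + n := hi₀.trans le_self_add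
    obtain ⟨w, hw⟩ := htrunc _ hn hnl
    refine map_mul_lt_of_lt (hn1 n (by omega) w hw) (hn2 n (by omega) w hw)
      (hn3 n (by omega) w hw) (hn4 n (by omega) w hw) e' ?_
      fun h => hq0 (hwtop _ hn hnl w hw q h)
    have hDn := hQ.degreeData _ hn (hnl.trans hL)
    have hD₀ := hQ.degreeData i₀ hi₀ (hi₀l.trans hL)
    obtain ⟨-, hdeg⟩ := monic_of_weaklyAffine hD₀.monic (c := fun j => evalSum Q (c j))
      (fun j => hD₀.degree_lt (hc j)) hp htop
    rw [← hQe] at hdeg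
    have hdeg' : (Q (i₀ + Ordinal.omega0)).natDegree = p ^ e * (Q (i₀ + n)).natDegree := by
      refine le_antisymm ?_ ?_
      · rw [hdeg]; exact Nat.mul_le_mul_left _ (hDn.mono i₀ hi₀ le_self_add)
      · rw [← hαe]; exact hD.mul_le _ hn (Or.inr (add_nat_add_omega0 i₀ n).symm)
    refine lt_of_le_of_lt (hw.le_of_monic hDn.monic hDn.degree_pos hD.monic hdeg')
      (lt_of_lt_of_le ?_ hle)
    obtain ⟨b, hb⟩ := WithTop.ne_top_iff_exists.1 (hlt' _ hn hnl).ne_top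
    have hlt := hlt' _ hn hnl
    rw [← hb] at hlt ⊢
    rw [← WithTop.coe_nsmul, ← WithTop.coe_nsmul, WithTop.coe_lt_coe]
    exact nsmul_lt_nsmul_right (pow_pos hp.pos e).ne' (WithTop.coe_lt_coe.1 hlt)

end Family

end Truncation

/-! ### Truncations at consecutive key polynomials of the same degree -/

section Consecutive

variable {K : Type u} [Field K] {Γ : Type v} [AddCommGroup Γ] [LinearOrder Γ]
  [IsOrderedAddMonoid Γ]
  {ν : AddValuation K (WithTop Γ)} {μ : AddValuation K[X] (WithTop Γ)}
  {L : Ordinal.{0}} {Q : Ordinal.{0} → K[X]} {α : Ordinal.{0} → ℕ} {l : Ordinal.{0}}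

theorem IsTruncAt.isTruncation (hD : DegreeData Q α l) {w : AddValuation K[X] (WithTop Γ)}
    (hw : IsTruncAt μ (Q l) w) : IsTruncation μ Q α l w := by
  rintro h n c ⟨hc, rfl⟩
  rw [map_adic_expansion hw.minimal n _ fun j => hD.degree_lt (hc j), hw.self]
  exact Finset.inf_congr rfl fun j _ => by rw [hw.agree _ (hD.degree_lt (hc j)), add_comm]

/-- If `deg Q_{l+1} = deg Q_l`, the difference of the two has the value of `Q_l`. -/
theorem IsHOSFamily.succ_of_degree_eq (hQ : IsHOSFamily ν μ L Q α) (hμ : ∀ f, μ f = ⊤ → f = 0)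
    (h1 : 1 ≤ l) (hL : l + 1 < L) (hdeg : (Q l).degree = (Q (l + 1)).degree) :
    (Q (l + 1) - Q l).degree < (Q l).degree ∧ μ (Q (l + 1) - Q l) = μ (Q l) ∧
      μ (Q l) < μ (Q (l + 1)) := by
  have hlt : l < l + 1 := lt_add_one l
  have hD := hQ.degreeData l h1 (hlt.trans hL)
  have hD' := hQ.degreeData (l + 1) (h1.trans hlt.le) hL
  have hα1 : α (l + 1) = 1 := by
    have h := hD'.succ_eq l h1 rfl
    rw [← natDegree_eq_of_degree_eq hdeg] at h
    have := hD.pos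
    nlinarith
  have hval := hQ.nsmul_lt_succ hμ h1 hL
  rw [hα1, one_nsmul] at hval
  refine ⟨?_, μ.map_sub_eq_of_lt_right hval, hval⟩
  rw [hdeg]
  exact degree_sub_lt_left hdeg.symm hD'.monic.ne_zero
    (by rw [hD.monic.leadingCoeff, hD'.monic.leadingCoeff])

/-- Values of polynomials of degree less than `deg R` may be added: replace a product by its
remainder. -/
theorem ProductCondition.exists_degree_lt_val {R : K[X]} (hT : ProductCondition μ R)
    (hR : R.Monic) {z : K[X]} (hz : z.degree < R.degree)
    {a : K[X]} (ha : a.degree < R.degree) (j : ℕ) :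
    ∃ y : K[X], y.degree < R.degree ∧ μ y = μ a + j • μ z := by
  induction j with
  | zero => exact ⟨a, ha, by simp⟩
  | succ j ih =>
    obtain ⟨y, hy, e⟩ := ih
    obtain ⟨r, q, hr, e'⟩ := exists_div hR (y * z)
    refine ⟨r, hr, ?_⟩
    rw [hT.map_remainder hy hz hr (q := q) (by rw [e']; ring), μ.map_mul, e, succ_nsmul, add_assoc]

/-- The set of values of `K[x]` under the truncation at `R` is the set of values of polynomials of
degree less than `deg R`, provided the value of `R` is one of them. -/
theorem IsTruncAt.exists_degree_lt_val {R : K[X]} {w : AddValuation K[X] (WithTop Γ)}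
    (hw : IsTruncAt μ R w) (hT : ProductCondition μ R) (hR : R.Monic) (hd : 0 < R.degree)
    {z : K[X]} (hz : z.degree < R.degree) (hzR : μ z = μ R) (f : K[X]) :
    ∃ y : K[X], y.degree < R.degree ∧ μ y = w f := by
  obtain ⟨m, a, ha, rfl⟩ := exists_adic_expansion hR hd f
  rw [map_adic_expansion hw.minimal m a ha]
  obtain ⟨j, hj, hj'⟩ := Finset.exists_mem_eq_inf (Finset.range (m + 1)) (by simp)
    fun j => w (a j) + j • w R
  rw [hj', hw.agree _ (ha j), hw.self, ← hzR]
  exact hT.exists_degree_lt_val hR hz (ha j) j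

/-- For monic `φ`, `ψ` of the same degree with `v φ < v ψ`, the truncation `w` of `v` at `φ` gives
`ψ` the value of `φ`, since it gives that value to `ψ - φ`. The truncation of `v` at `ψ` is then an
augmentation of `w`. -/
theorem IsTruncAt.isAugmentation {v w w' : AddValuation K[X] (WithTop Γ)} {φ ψ : K[X]}
    (htop : ∀ f, v f = ⊤ → f = 0) (hw : IsTruncAt v φ w) (hw' : IsTruncAt v ψ w')
    (hφ : φ.Monic) (hψ : ψ.Monic) (hd : 0 < φ.degree) (hdeg : φ.degree = ψ.degree)
    (hlt : v φ < v ψ) {γ : Γ} (hγ : v ψ = γ) :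
    IsAugmentation w ψ γ w' ∧ ¬ ValEquiv w ψ φ := by
  have hy : (ψ - φ).degree < φ.degree := by
    rw [hdeg]
    exact degree_sub_lt_left hdeg.symm hψ.ne_zero (by rw [hφ.leadingCoeff, hψ.leadingCoeff])
  have hvy : w (ψ - φ) = v φ := by rw [hw.agree _ hy]; exact v.map_sub_eq_of_lt_right hlt
  have hwψ : w ψ = v φ := by
    have e : ψ = (ψ - φ) + 1 * φ := by ring
    rw [e, map_add_mul_of_isMinimalFor hw.minimal hy, hvy, w.map_one, zero_add, hw.self, min_self]
  have hle := hw.le hφ hd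
  have hagv : AgreeBelow w v ψ := fun a ha => hw.agree a (by rwa [hdeg])
  have hmin : IsMinimalFor w ψ := isMinimalFor_of_lt hle hagv (by rwa [hwψ])
  have htop' : ∀ f, w f = ⊤ → f = 0 := fun f hf => htop f (top_le_iff.1 (hf ▸ hle f))
  have hag : AgreeBelow w w' ψ := fun a ha => by rw [hagv a ha, hw'.agree a ha]
  refine ⟨isAugmentation_of_lt hψ (hdeg ▸ hd) htop' hmin hag (by rwa [hwψ, hw'.self]) hw'.minimal
    (hw'.self.trans hγ), fun h => ?_⟩
  rw [ValEquiv, initial_eq_iff w (by rw [hwψ]; exact hlt.ne_top), w.map_sub_swap, hwψ, hvy] at h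
  exact h.false

/-- Truncations of `v` at monic polynomials of the same degree are ordered as the values of these
polynomials. -/
theorem IsTruncAt.le_of_val_le {v w w' : AddValuation K[X] (WithTop Γ)} {φ ψ : K[X]}
    (hw : IsTruncAt v φ w) (hw' : IsTruncAt v ψ w') (hφ : φ.Monic) (hψ : ψ.Monic)
    (hd : 0 < φ.degree) (hdeg : φ.degree = ψ.degree) (hle : v φ ≤ v ψ) (f : K[X]) :
    w f ≤ w' f := by
  refine le_of_isMinimalFor hφ hd hw.minimal
    (fun a ha => by rw [hw.agree a ha, hw'.agree a (by rwa [← hdeg])]) ?_ f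
  have hy : (φ - ψ).degree < ψ.degree := by
    rw [← hdeg]
    exact degree_sub_lt_left hdeg hφ.ne_zero (by rw [hφ.leadingCoeff, hψ.leadingCoeff])
  have e : φ = (φ - ψ) + ψ := by ring
  conv_rhs => rw [e]
  refine le_trans (le_min ?_ ?_) (w'.map_add _ _)
  · rw [hw'.agree _ hy, hw.self]
    exact le_trans (le_min le_rfl hle) (v.map_sub _ _)
  · rwa [hw.self, hw'.self]

end Consecutive

/-- Truncations of one valuation `v` at monic polynomials of the same degree with strictly
increasing values form a family of augmented iterated valuations. -/
theorem isAugmentedIteratedFamily_of_isTruncAt {K : Type u} [Field K] {Γ : Type v}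
    [AddCommGroup Γ] [LinearOrder Γ] [IsOrderedAddMonoid Γ] {v : AddValuation K[X] (WithTop Γ)}
    (htop : ∀ f, v f = ⊤ → f = 0) {Δ : Set Γ} {R : Δ → K[X]}
    {w : Δ → AddValuation K[X] (WithTop Γ)} {d : WithBot ℕ} (hd : 0 < d)
    (hR : ∀ δ, (R δ).Monic) (hdeg : ∀ δ, (R δ).degree = d)
    (hv : ∀ δ : Δ, v (R δ) = (δ : Γ)) (hw : ∀ δ, IsTruncAt v (R δ) (w δ)) :
    IsAugmentedIteratedFamily w R (fun δ => (δ : Γ)) := by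
  have key : ∀ θ δ : Δ, θ < δ →
      IsAugmentation (w θ) (R δ) (δ : Γ) (w δ) ∧ ¬ ValEquiv (w θ) (R δ) (R θ) := by
    intro θ δ h
    refine (hw θ).isAugmentation htop (hw δ) (hR θ) (hR δ) (by rwa [hdeg])
      ((hdeg θ).trans (hdeg δ).symm) ?_ (hv δ)
    rw [hv, hv, WithTop.coe_lt_coe]
    exact h
  intro δ hδ
  obtain ⟨θ, hθ, hpred⟩ : ∃ θ < δ, ∀ π, π ⋖ δ → θ = π := by
    by_cases h : ∃ π, π ⋖ δ
    · obtain ⟨π, hπ⟩ := h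
      exact ⟨π, hπ.lt, fun π' hπ' => hπ.unique_left hπ'⟩
    · obtain ⟨θ, hθ⟩ := not_isMin_iff.1 hδ
      exact ⟨θ, hθ, fun π hπ => absurd ⟨π, hπ⟩ h⟩
  refine ⟨θ, hθ, (key θ δ hθ).1, fun π hπ => ⟨hpred π hπ, fun _ => ⟨(key θ δ hθ).2, ?_⟩⟩,
    fun _ β h1 h2 => ⟨(key θ β h1).1, (key β δ h2).1, ?_⟩⟩
  · rw [hdeg, hdeg]
  · rw [hdeg, hdeg]

end KeyPoly

theorem mainTheorem5 {K : Type*} [Field K] {Γ : Type*} [AddCommGroup Γ] [LinearOrder Γ]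
    [IsOrderedAddMonoid Γ]
    (ν : AddValuation K (WithTop Γ)) (hν : KeyPoly.IsRankOne ν)
    (μ : AddValuation K[X] (WithTop Γ)) (hμν : ∀ a : K, μ (C a) = ν a)
    (hμ : ∀ f : K[X], μ f = ⊤ → f = 0)
    (L : Ordinal.{0}) (Q : Ordinal.{0} → K[X]) (α : Ordinal.{0} → ℕ)
    (hQ : KeyPoly.IsHOSFamily ν μ L Q α)
    (i : Ordinal.{0}) (hi : 1 ≤ i) (hiL : i + 1 < L)
    (hdeg : (Q i).degree = (Q (i + 1)).degree) :
    ∃ νi νi1 : AddValuation K[X] (WithTop Γ),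
      KeyPoly.IsTruncation μ Q α i νi ∧ KeyPoly.IsTruncation μ Q α (i + 1) νi1 ∧
      -- existence of the polynomials `Q_δ`
      (∀ β : Γ, μ (Q i) < β → β < μ (Q (i + 1)) → (∃ f : K[X], νi f = β) →
        ∃ P : K[X], KeyPoly.IsDeltaPoly μ Q α i νi νi1 β P) ∧
      -- any choice of polynomials `Q_δ`, the endpoints `β_i` (with `Q_i`) and `β_{i+1}` allowed
      (∀ (Δ : Set Γ) (R : Δ → K[X]),
        (∀ δ : Δ, μ (Q i) ≤ ((δ : Γ) : WithTop Γ) ∧ ((δ : Γ) : WithTop Γ) ≤ μ (Q (i + 1))) →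
        (∀ δ : Δ, μ (Q i) < ((δ : Γ) : WithTop Γ) →
          KeyPoly.IsDeltaPoly μ Q α i νi νi1 (δ : Γ) (R δ)) →
        (∀ δ : Δ, ((δ : Γ) : WithTop Γ) = μ (Q i) → R δ = Q i) →
        ∃ νδ : Δ → AddValuation K[X] (WithTop Γ),
          (∀ δ : Δ, μ (Q i) < ((δ : Γ) : WithTop Γ) →
            KeyPoly.IsAugmentation νi (R δ) (δ : Γ) (νδ δ)) ∧
          (∀ δ : Δ, ((δ : Γ) : WithTop Γ) = μ (Q i) → νδ δ = νi) ∧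
          (∀ δ : Δ, ((δ : Γ) : WithTop Γ) = μ (Q (i + 1)) → νδ δ = νi1) ∧
          KeyPoly.IsAugmentedIteratedFamily νδ R (fun δ => (δ : Γ))) := by
  have hlt : i < i + 1 := lt_add_one i
  have hi' : 1 ≤ i + 1 := hi.trans hlt.le
  have hD := hQ.degreeData i hi (hlt.trans hiL)
  have hD' := hQ.degreeData (i + 1) hi' hiL
  have hT := hQ.productCondition hμ hi (hlt.trans hiL)
  obtain ⟨w, hw⟩ := hT.exists_isTruncAt hD.monic hD.degree_pos
  obtain ⟨w', hw'⟩ := (hQ.productCondition hμ hi' hiL).exists_isTruncAt hD'.monic hD'.degree_pos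
  obtain ⟨hz, hzval, hval⟩ := hQ.succ_of_degree_eq hμ hi hiL hdeg
  have hle' := hw'.le hD'.monic hD'.degree_pos
  have htop' : ∀ f, w' f = ⊤ → f = 0 := fun f hf => hμ f (top_le_iff.1 (hf ▸ hle' f))
  -- `w` is also the truncation of `w'` at `Q i`
  have hww' : KeyPoly.IsTruncAt w' (Q i) w := by
    refine ⟨fun a ha => ?_, ?_, hw.minimal⟩
    · rw [hw.agree a ha, hw'.agree a (by rwa [← hdeg])]
    · rw [hw.self, hw'.map_earlier hQ hμ hiL hi hlt.le]
  have hself : KeyPoly.IsTruncAt w' (Q (i + 1)) w' := ⟨fun _ _ => rfl, rfl, hw'.minimal⟩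
  have htop : ∀ f, w f = ⊤ → f = 0 := fun f hf =>
    htop' f (top_le_iff.1 (hf ▸ hww'.le hD.monic hD.degree_pos f))
  refine ⟨w, w', hw.isTruncation hD, hw'.isTruncation hD', ?_, ?_⟩
  · rintro β hβ hβ' ⟨f, hf⟩
    obtain ⟨y, hy, hyval⟩ := hw.exists_degree_lt_val hT hD.monic hD.degree_pos hz hzval f
    rw [hf] at hyval
    have hzy : (Q (i + 1) - Q i + y).degree < (Q i).degree :=
      lt_of_le_of_lt (degree_add_le _ _) (max_lt hz hy)
    have hzyval : w (Q (i + 1) - Q i + y) = μ (Q i) := by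
      rw [hw.agree _ hzy, μ.map_add_eq_of_lt_left (by rwa [hzval, hyval]), hzval]
    obtain ⟨s, hs, hse⟩ := hQ.exists_std_of_degree_lt hi (hlt.trans hiL) hzy
    refine ⟨Q i + KeyPoly.evalSum Q s, s, hs, rfl, ?_, ?_, ?_, hβ⟩
    · rw [hse]
      have e : Q i + (Q (i + 1) - Q i + y) = (Q (i + 1) - Q i + y) + 1 * Q i := by ring
      rw [e, KeyPoly.map_add_mul_of_isMinimalFor hw.minimal hzy, hzyval, w.map_one, zero_add,
        hw.self, min_self]
    · rw [hse, hzyval, hw.self]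
    · have hy' : y.degree < (Q (i + 1)).degree := by rwa [← hdeg]
      have e : Q i + (Q (i + 1) - Q i + y) = y + 1 * Q (i + 1) := by ring
      rw [hse, e, KeyPoly.map_add_mul_of_isMinimalFor hw'.minimal hy', hw'.agree y hy', hyval,
        w'.map_one, zero_add, hw'.self, min_eq_left hβ'.le]
  · intro Δ R hΔ hR hR0
    have hcases : ∀ δ : Δ, ((δ : Γ) : WithTop Γ) = μ (Q i) ∨ μ (Q i) < ((δ : Γ) : WithTop Γ) :=
      fun δ => (hΔ δ).1.eq_or_lt.imp_left Eq.symm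
    have hRi : ∀ δ, (R δ).Monic ∧ (R δ).degree = (Q i).degree ∧
        w' (R δ) = ((δ : Γ) : WithTop Γ) := by
      intro δ
      rcases hcases δ with h | h
      · rw [hR0 δ h, h]
        exact ⟨hD.monic, rfl, hw'.map_earlier hQ hμ hiL hi hlt.le⟩
      · obtain ⟨s, hs, e, -, -, hv, -⟩ := hR δ h
        have hsd := hD.degree_lt hs
        rw [e] at hv ⊢
        exact ⟨hD.monic.add_of_left hsd, degree_add_eq_left_of_degree_lt hsd, hv⟩
    have hex : ∀ δ, ∃ u, KeyPoly.IsTruncAt w' (R δ) u := by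
      intro δ
      obtain ⟨hmon, hd, hv⟩ := hRi δ
      rcases hcases δ with h | h
      · rw [hR0 δ h]; exact ⟨w, hww'⟩
      · obtain ⟨s, -, -, hwR, -⟩ := hR δ h
        refine (KeyPoly.productCondition_of_lt htop (u := w) (fun a ha => hww'.agree a ?_)
          ?_).exists_isTruncAt hmon (by rw [hd]; exact hD.degree_pos)
        · rwa [← hd]
        · rwa [hwR, hw.self, hv]
    choose u hu using hex
    -- truncations of `w'` at polynomials of the same degree and value coincide
    have heq : ∀ (δ : Δ) (φ : K[X]) (t : AddValuation K[X] (WithTop Γ)), φ.Monic →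
        φ.degree = (Q i).degree → KeyPoly.IsTruncAt w' φ t → w' (R δ) = w' φ → u δ = t := by
      intro δ φ t hφ hφd ht hv
      obtain ⟨hmon, hd, -⟩ := hRi δ
      have hdd : (R δ).degree = φ.degree := hd.trans hφd.symm
      have hpos : 0 < φ.degree := hφd ▸ hD.degree_pos
      exact AddValuation.ext fun f => le_antisymm
        ((hu δ).le_of_val_le ht hmon hφ (hdd ▸ hpos) hdd hv.le f)
        (ht.le_of_val_le (hu δ) hφ hmon hpos hdd.symm hv.ge f)
    refine ⟨u, fun δ h => ?_, fun δ h => ?_, fun δ h => ?_, ?_⟩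
    · obtain ⟨hmon, hd, hv⟩ := hRi δ
      refine (hww'.isAugmentation htop' (hu δ) hD.monic hmon hD.degree_pos hd.symm ?_ hv).1
      rwa [hv, ← hww'.self, hw.self]
    · refine heq δ (Q i) w hD.monic rfl hww' ?_
      rw [(hRi δ).2.2, h, ← hww'.self, hw.self]
    · refine heq δ (Q (i + 1)) w' hD'.monic hdeg.symm hself ?_
      rw [(hRi δ).2.2, h, hw'.self]
    · exact KeyPoly.isAugmentedIteratedFamily_of_isTruncAt htop' hD.degree_pos
        (fun δ => (hRi δ).1) (fun δ => (hRi δ).2.1) (fun δ => (hRi δ).2.2) hu
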